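/- Let $m\ge 1$ be an integer and $a>0$. Consider the first-come-first-served $D/GI/m/\infty$ queue with $m$ servers, constant interarrival times $a$ and i.i.d. service times $(\sigma_n)_{n\in\mathbb Z}$ with distribution $F$ on $[0,\infty)$, tail $\overline F=1-F$ and finite mean $b=\mathbf E\sigma_0$, and assume that it is stable: $\rho=\frac{b}{ma}\in(0,1)$. A distribution $G$ on $[0,\infty)$ with $\overline G(x)>0$ for all $x$ is called subexponential if $\mathbf P(\xi_1+\xi_2>x)\sim 2\,\overline G(x)$ as $x\to\infty$, where $\xi_1,\xi_2$ are independent with distribution $G$. Assume that $F$ and its integrated tail distribution $F^s$, defined on $[0,\infty)$ by $\overline{F}^s(x)=1-F^s(x)=\min\{1,\int_x^\infty\overline F(u)\,du\}$, are both subexponential. For $n\ge 0$ let $W_{-n},\dots,W_0$ be the Kiefer–Wolfowitz workload vectors of the queue started empty at the arrival of customer $-n$, that is, $W_{-n}=0$ and $W_{k+1}=\mathbf R\,(W_k+\sigma_k\mathbf e_1-a\mathbf i)^+$, where $\mathbf e_1=(1,0,\dots,0)$, $\mathbf i=(1,\dots,1)$, the positive part is taken componentwise and $\mathbf R$ rearranges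 the components in nondecreasing order. Let $Z_{[-n,0]}=\max(W_0^{(1)}+\sigma_0,\,W_0^{(m)})$, and let $Z=\lim_{n\to\infty}Z_{[-n,0]}\in[0,\infty]$ be the stationary maximal dater; the limit exists because $Z_{[-n,0]}$ is nondecreasing in $n$. Then, as $x\to\infty$, $$\mathbf P(Z>x)=(1+o(1))\left(\frac1a\,\overline F^s(x)+\left(\frac1{ma-b}-\frac1a\right)^+\overline F^s\!\left(\frac{bx}{b-(m-1)a}\right)\right).$$ The second term in the parentheses is $0$ when $b\le (m-1)a$ (it is then read as $0$ whatever the argument of $\overline F^s$). -/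

import Mathlib

open MeasureTheory ProbabilityTheory Filter Set Asymptotics
open scoped Topology ENNReal

noncomputable section

namespace MultiserverTail

/-! ### Subexponential distributions and integrated tails -/

/-- The tail `x ↦ F(x, ∞)` of a distribution on the real line. -/
def tail (F : Measure ℝ) (x : ℝ) : ℝ := F.real (Ioi x)

/-- A subexponential distribution: a probability distribution on `[0, ∞)` whose tail is strictly
positive everywhere and such that `P(ξ₁ + ξ₂ > x) ~ 2 P(ξ₁ > x)` as `x → ∞`, for two independent
random variables `ξ₁`, `ξ₂` with this distribution (the law of `ξ₁ + ξ₂` is the convolution). -/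
structure IsSubexponential (F : Measure ℝ) : Prop where
  isProbabilityMeasure : IsProbabilityMeasure F
  nonneg : F (Iio 0) = 0
  tail_pos : ∀ x : ℝ, 0 < tail F x
  conv_tail : tail (F.conv F) ~[atTop] fun x => 2 * tail F x

/-- The tail of the integrated tail distribution of `F`, namely
`x ↦ min {1, ∫_x^∞ F(u, ∞) du}`. The integral is a Lebesgue integral with values in `[0, ∞]`. -/
def integratedTail (F : Measure ℝ) (x : ℝ) : ℝ :=
  (min 1 (∫⁻ u in Ioi x, F (Ioi u))).toReal

lemma integratedTail_antitone (F : Measure ℝ) : Antitone (integratedTail F) := by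
  intro x y hxy
  unfold integratedTail
  refine ENNReal.toReal_mono (ne_top_of_le_ne_top ENNReal.one_ne_top (min_le_left _ _)) ?_
  exact min_le_min le_rfl (lintegral_mono_set (Ioi_subset_Ioi hxy))

lemma integratedTail_nonneg (F : Measure ℝ) (x : ℝ) : 0 ≤ integratedTail F x :=
  ENNReal.toReal_nonneg

lemma integratedTail_le_one (F : Measure ℝ) (x : ℝ) : integratedTail F x ≤ 1 := by
  unfold integratedTail
  exact ENNReal.toReal_le_of_le_ofReal zero_le_one (by simp)

lemma integratedTail_le_add (F : Measure ℝ) [IsProbabilityMeasure F] {x y : ℝ} (hxy : x ≤ y) :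
    integratedTail F x ≤ integratedTail F y + (y - x) := by
  have hJ : (∫⁻ u in Ioi x, F (Ioi u)) ≤
      (∫⁻ u in Ioi y, F (Ioi u)) + ENNReal.ofReal (y - x) := by
    rw [← Ioc_union_Ioi_eq_Ioi hxy, add_comm]
    refine (lintegral_union_le _ _ _).trans (add_le_add ?_ le_rfl)
    calc (∫⁻ u in Ioc x y, F (Ioi u)) ≤ ∫⁻ _ in Ioc x y, 1 :=
          lintegral_mono fun u => prob_le_one
      _ = ENNReal.ofReal (y - x) := by simp
  have hm : min 1 (∫⁻ u in Ioi x, F (Ioi u)) ≤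
      min 1 (∫⁻ u in Ioi y, F (Ioi u)) + ENNReal.ofReal (y - x) := by
    rcases le_total 1 (∫⁻ u in Ioi y, F (Ioi u)) with h | h
    · rw [min_eq_left h]
      exact (min_le_left _ _).trans le_self_add
    · rw [min_eq_right h]
      exact (min_le_right _ _).trans hJ
  have hfin : min 1 (∫⁻ u in Ioi y, F (Ioi u)) ≠ ∞ :=
    ne_top_of_le_ne_top ENNReal.one_ne_top (min_le_left _ _)
  unfold integratedTail
  have h := ENNReal.toReal_mono (ENNReal.add_ne_top.2 ⟨hfin, ENNReal.ofReal_ne_top⟩) hm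
  rwa [ENNReal.toReal_add hfin ENNReal.ofReal_ne_top,
    ENNReal.toReal_ofReal (sub_nonneg.2 hxy)] at h

/-- The distribution function `F^s` on `[0, ∞)` of the integrated tail distribution:
`F^s(x) = 1 - min {1, ∫_x^∞ F(u, ∞) du}` for `x ≥ 0`, and `F^s(x) = 0` for `x < 0`. -/
def integratedCDF (F : Measure ℝ) [IsProbabilityMeasure F] : StieltjesFunction ℝ where
  toFun x := if x < 0 then 0 else 1 - integratedTail F x
  mono' := by
    intro x y hxy
    have h1 := integratedTail_antitone F hxy
    have h2 := integratedTail_le_one F y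
    dsimp only
    split_ifs <;> linarith
  right_continuous' := by
    intro x
    rcases lt_or_ge x 0 with hx | hx
    · refine ContinuousAt.continuousWithinAt ?_
      refine (continuousAt_const (y := (0 : ℝ))).congr ?_
      filter_upwards [Iio_mem_nhds hx] with y hy
      exact (if_pos hy).symm
    · have key : ContinuousWithinAt (fun y => 1 - integratedTail F y) (Ici x) x := by
        refine ContinuousWithinAt.sub continuousWithinAt_const ?_
        have hlow : Tendsto (fun y : ℝ => integratedTail F x - (y - x)) (𝓝[Ici x] x)
            (𝓝 (integratedTail F x)) := by
          have : Continuous fun y : ℝ => integratedTail F x - (y - x) := by fun_prop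
          simpa using (this.tendsto x).mono_left nhdsWithin_le_nhds
        refine tendsto_of_tendsto_of_tendsto_of_le_of_le' hlow tendsto_const_nhds ?_ ?_
        · filter_upwards [self_mem_nhdsWithin] with y hy
          have := integratedTail_le_add F (mem_Ici.1 hy)
          linarith
        · filter_upwards [self_mem_nhdsWithin] with y hy
          exact integratedTail_antitone F (mem_Ici.1 hy)
      refine key.congr (fun y hy => ?_) ?_
      · exact if_neg (not_lt.2 (hx.trans hy))
      · exact if_neg (not_lt.2 hx)

/-- The integrated tail distribution, as a measure: its distribution function is `F^s`. -/
def integratedDist (F : Measure ℝ) [IsProbabilityMeasure F] : Measure ℝ :=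
  (integratedCDF F).measure

/-! ### The multiserver queue -/

variable {m : ℕ}

/-- The operator `R`, which rearranges the components of a vector in nondecreasing order. -/
def rearrange (v : Fin m → ℝ) : Fin m → ℝ := v ∘ Tuple.sort v

/-- The Kiefer–Wolfowitz workload vector at the arrival of customer `n` in the `m`-server
queue with constant interarrival times `a` and service times `s 0, s 1, …`, started empty:
`W₀ = 0` and `W_{n+1} = R (W_n + s_n e₁ - a (1, …, 1))⁺`. -/
def workload [NeZero m] (a : ℝ) (s : ℕ → ℝ) : ℕ → Fin m → ℝ
  | 0 => 0
  | n + 1 => rearrange fun i => max (workload a s n i + (Pi.single 0 (s n) : Fin m → ℝ) i - a) 0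

/-- The maximal dater `Z_{[0,n]} = max (W_n⁽¹⁾ + s_n, W_n⁽ᵐ⁾)`: the time between the arrival of
customer `n` and the departure of the last of the customers `0, …, n`. -/
def dater (m : ℕ) [NeZero m] (a : ℝ) (s : ℕ → ℝ) (n : ℕ) : ℝ :=
  max (workload (m := m) a s n 0 + s n)
    (workload (m := m) a s n ⟨m - 1, Nat.sub_lt (NeZero.pos m) one_pos⟩)

/-- The maximal dater `Z_{[-n,0]}` of a doubly infinite sequence `s` of service times: the queue
starts empty at the arrival of customer `-n`. -/
def backwardDater (m : ℕ) [NeZero m] (a : ℝ) (s : ℤ → ℝ) (n : ℕ) : ℝ :=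
  dater m a (fun k => s ((k : ℤ) - n)) n

/-- The stationary maximal dater `Z = lim_{n → ∞} Z_{[-n,0]} ≤ ∞`, in the extended reals; the limit
exists by `tendsto_stationaryDater`. -/
def stationaryDater (m : ℕ) [NeZero m] (a : ℝ) (s : ℤ → ℝ) : EReal :=
  limUnder atTop fun n : ℕ => (backwardDater m a s n : EReal)

lemma rearrange_mono : Monotone (rearrange : (Fin m → ℝ) → Fin m → ℝ) := by
  intro v w hvw i
  by_contra! hlt
  have hcard : (Finset.Iic i).card ≤ (Finset.Iio i).card := by
    refine Finset.card_le_card_of_injOn (fun j => (Tuple.sort v).symm (Tuple.sort w j)) ?_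
      (fun _ _ _ _ h => (Tuple.sort w).injective ((Tuple.sort v).symm.injective h))
    intro j hj
    have hj' : j ≤ i := by simpa using hj
    have h1 : w (Tuple.sort w j) ≤ rearrange w i := Tuple.monotone_sort w hj'
    have h2 : v (Tuple.sort w j) ≤ w (Tuple.sort w j) := hvw _
    have h3 : rearrange v ((Tuple.sort v).symm (Tuple.sort w j)) = v (Tuple.sort w j) := by
      simp [rearrange]
    have h4 : (Tuple.sort v).symm (Tuple.sort w j) < i := by
      by_contra! h
      have h5 : rearrange v i ≤ rearrange v ((Tuple.sort v).symm (Tuple.sort w j)) :=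
        Tuple.monotone_sort v h
      linarith
    simpa using h4
  simp at hcard

lemma workload_nonneg [NeZero m] (a : ℝ) (s : ℕ → ℝ) (n : ℕ) : 0 ≤ workload (m := m) a s n := by
  cases n with
  | zero => exact le_rfl
  | succ n => exact fun i => le_max_right _ _

lemma workload_le_succ [NeZero m] (a : ℝ) (s : ℕ → ℝ) (n : ℕ) :
    workload (m := m) a (fun k => s (k + 1)) n ≤ workload a s (n + 1) := by
  induction n with
  | zero => exact workload_nonneg a s 1
  | succ n ih =>
    refine rearrange_mono fun i => max_le_max ?_ le_rfl
    have := ih i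
    gcongr

lemma backwardDater_mono (m : ℕ) [NeZero m] (a : ℝ) (s : ℤ → ℝ) :
    Monotone (backwardDater m a s) := by
  refine monotone_nat_of_le_succ fun n => ?_
  have h := workload_le_succ (m := m) a (fun k => s ((k : ℤ) - (n + 1 : ℕ))) n
  have hs : (fun k : ℕ => s (((k + 1 : ℕ) : ℤ) - (n + 1 : ℕ))) = fun k : ℕ => s ((k : ℤ) - n) := by
    funext k
    congr 1
    push_cast
    ring
  rw [hs] at h
  unfold backwardDater dater
  refine max_le_max (add_le_add (h _) (le_of_eq ?_)) (h _)
  simp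

/-- The limit that defines the stationary maximal dater exists. -/
lemma tendsto_stationaryDater (m : ℕ) [NeZero m] (a : ℝ) (s : ℤ → ℝ) :
    Tendsto (fun n : ℕ => (backwardDater m a s n : EReal)) atTop (𝓝 (stationaryDater m a s)) :=
  tendsto_nhds_limUnder ⟨_, tendsto_atTop_iSup fun _ _ h =>
    EReal.coe_le_coe_iff.2 (backwardDater_mono m a s h)⟩

end MultiserverTail

end

noncomputable section

namespace MultiserverTail

/-! ### Tails -/

/-! The proof makes the principle of a single big jump precise. Read time backwards, so that `x n`
is the service time of the customer who arrived `n` steps ago, and put `d = m * a - b`. If that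
customer brings a huge `y` to a nearly empty queue and all else follows the law of large numbers,
then its own server still holds `y - n * a`. If the other `m - 1` servers cannot carry the load,
work piles up until the total `y - n * d` is spread evenly, which is `(y - n * d) / m` per server.
The dater exceeds `v` when the larger of the two does, that is, when `y` exceeds `fluidLevel`, the
minimum of `v + n * a` and `m * v + n * d`. Summing the probabilities over `n` gives the integral of
the tail along this level. The two lines meet, if `d < a`, at height `b * v / (b - (m - 1) * a)`,
and splitting the integral there gives both terms of the answer (`fluidIntegral_eq`).

For the upper bound, the workload is dominated by a reflected random walk with negative drift
(`Dominates.step`). When that walk is large, consider its first crossing of a decreasing line of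
small negative slope. Either the crossing step is itself a large jump, or the walk restarted after
the crossing is large, which costs an extra small factor because the line is rarely crossed, or both
parts are large, which subexponentiality of the integrated tail makes negligible
(`eventually_both_large_le`). This first gives a crude bound of the right order, uniform in time
(`exists_real_reflected_le`), and then, reinserted, localizes everything at one jump
(`exists_real_pastDater_le`). The deterministic estimate `exists_pastDater_le` shows that such a
jump must exceed the fluid level, up to constants and a factor `1 - ε` in time.

For the lower bound, a jump above a slightly raised fluid level, with regular later service times,
forces a large dater (`lt_pastDater`). Restricting to the smallest index of such a jump makes the
events disjoint, at the price of a factor close to 1 (`exists_le_real_pastDater`). Constant shifts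
of the level are harmless because the integrated tail is long-tailed, and `tail F` itself is
negligible against it. -/

lemma tail_antitone (F : Measure ℝ) [IsFiniteMeasure F] : Antitone (tail F) :=
  fun _ _ h => measureReal_mono (Ioi_subset_Ioi h)

lemma tail_nonneg (F : Measure ℝ) (x : ℝ) : 0 ≤ tail F x := measureReal_nonneg

lemma tail_le_one (F : Measure ℝ) [IsProbabilityMeasure F] (x : ℝ) : tail F x ≤ 1 :=
  measureReal_le_one

lemma tendsto_tail (F : Measure ℝ) [IsFiniteMeasure F] : Tendsto (tail F) atTop (𝓝 0) := by
  have h : Tendsto (fun x : ℝ => F (Ioi x)) atTop (𝓝 (F (⋂ x : ℝ, Ioi x))) :=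
    tendsto_measure_iInter_atTop (fun x => measurableSet_Ioi.nullMeasurableSet)
      (fun _ _ h => Ioi_subset_Ioi h) ⟨0, measure_ne_top _ _⟩
  have h0 : (⋂ x : ℝ, Ioi x) = ∅ := by
    ext y
    simp only [mem_iInter, mem_Ioi, mem_empty_iff_false, iff_false, not_forall, not_lt]
    exact ⟨y, le_rfl⟩
  rw [h0, measure_empty] at h
  exact (ENNReal.tendsto_toReal ENNReal.zero_ne_top).comp h

lemma tail_conv (F : Measure ℝ) [IsProbabilityMeasure F] (x : ℝ) :
    tail (F.conv F) x = (F.prod F).real {p | x < p.1 + p.2} := by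
  unfold tail Measure.conv
  rw [map_measureReal_apply (by fun_prop) measurableSet_Ioi]
  rfl

lemma IsSubexponential.real_Icc_zero {H : Measure ℝ} (hH : IsSubexponential H) {A : ℝ}
    (hA : 0 ≤ A) : H.real (Icc 0 A) = 1 - tail H A := by
  have := hH.isProbabilityMeasure
  have h1 : H.real (Iic A) = 1 - tail H A := by
    rw [← compl_Ioi, measureReal_compl measurableSet_Ioi, probReal_univ]; rfl
  rw [← h1, ← Iio_union_Icc_eq_Iic hA]
  refine (measureReal_congr ?_).symm
  rw [ae_eq_set]
  refine ⟨measure_mono_null ?_ hH.nonneg, measure_mono_null ?_ (measure_empty (μ := H))⟩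
  · rintro y ⟨h | h, h'⟩
    · exact h
    · exact absurd h h'
  · rintro y ⟨h, h'⟩
    exact h' (Or.inr h)

lemma IsSubexponential.eventually_conv_le {H : Measure ℝ} (hH : IsSubexponential H) {δ : ℝ}
    (hδ : 0 < δ) : ∀ᶠ x in atTop, (H.prod H).real {p | x < p.1 + p.2} ≤ (2 + δ) * tail H x := by
  have := hH.isProbabilityMeasure
  have h := hH.conv_tail.isLittleO.bound (half_pos hδ)
  filter_upwards [h] with x hx
  rw [← tail_conv]
  have hp := hH.tail_pos x
  simp only [Pi.sub_apply, Real.norm_eq_abs] at hx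
  rw [abs_of_pos (show 0 < 2 * tail H x by positivity)] at hx
  have := (abs_le.1 hx).2
  nlinarith

/-- Long-tailedness. The event that the sum exceeds `x` contains three essentially disjoint pieces,
according to whether the first variable lies above `x`, in `[0, A]`, or in `(A, x]`. In the last
piece the second variable need only exceed `x - A`, so a much larger tail there would push the sum
above the factor 2. -/
lemma IsSubexponential.eventually_tail_sub_le {H : Measure ℝ} (hH : IsSubexponential H) (A : ℝ)
    {κ : ℝ} (hκ : 1 < κ) : ∀ᶠ x in atTop, tail H (x - A) ≤ κ * tail H x := by
  have := hH.isProbabilityMeasure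
  wlog hA : 0 ≤ A generalizing A
  · filter_upwards [this 0 le_rfl] with x hx
    refine (tail_antitone H ?_).trans hx
    linarith
  have hp := hH.tail_pos A
  -- The solution of `(tail H A + δ) / (tail H A - δ) = κ`.
  set δ := tail H A * (κ - 1) / (κ + 1) with hδdef
  have hδ : 0 < δ := by
    have : 0 < κ - 1 := by linarith
    positivity
  have hδA : δ < tail H A := by
    rw [hδdef, div_lt_iff₀ (by linarith)]
    nlinarith
  filter_upwards [hH.eventually_conv_le hδ, (tendsto_tail H).eventually (gt_mem_nhds hδ),
    eventually_ge_atTop A] with x h1 h2 h3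
  have hb1 : (H.prod H).real (Ioi x ×ˢ univ) = tail H x := by
    simp [measureReal_prod_prod, tail]
  have hb2 : (H.prod H).real (Icc 0 A ×ˢ Ioi x) = (1 - tail H A) * tail H x := by
    rw [measureReal_prod_prod, hH.real_Icc_zero hA]; rfl
  have hb3 : (H.prod H).real (Ioc A x ×ˢ Ioi (x - A)) = (tail H A - tail H x) * tail H (x - A) := by
    rw [measureReal_prod_prod, ← Ioi_sdiff_Ioi,
      measureReal_sdiff (Ioi_subset_Ioi h3) measurableSet_Ioi]
    rfl
  have hd1 : Disjoint (Ioi x ×ˢ (univ : Set ℝ)) (Icc 0 A ×ˢ Ioi x) :=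
    Disjoint.set_prod_left (disjoint_left.2 fun y hy hy' => by
      have h4 : x < y := hy
      have h5 : y ≤ A := hy'.2
      linarith) _ _
  have hd2 : Disjoint (Ioi x ×ˢ (univ : Set ℝ) ∪ Icc 0 A ×ˢ Ioi x) (Ioc A x ×ˢ Ioi (x - A)) := by
    rw [disjoint_union_left]
    exact ⟨disjoint_left.2 fun y hy hy' => absurd hy'.1.2 (not_le.2 hy.1),
      disjoint_left.2 fun y hy hy' => absurd hy.1.2 (not_le.2 hy'.1.1)⟩
  have hneg : (H.prod H) {p | p.2 < 0} = 0 := by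
    have : {p : ℝ × ℝ | p.2 < 0} = univ ×ˢ Iio 0 := by ext p; simp
    rw [this, Measure.prod_prod, hH.nonneg, mul_zero]
  have hsum : (H.prod H).real ((Ioi x ×ˢ (univ : Set ℝ) ∪ Icc 0 A ×ˢ Ioi x) ∪
      Ioc A x ×ˢ Ioi (x - A)) ≤ (H.prod H).real {p | x < p.1 + p.2} := by
    refine ENNReal.toReal_mono (measure_ne_top _ _) (measure_mono_ae ?_)
    have e2 : ∀ᵐ p ∂(H.prod H), p ∉ {p : ℝ × ℝ | p.2 < 0} := measure_eq_zero_iff_ae_notMem.1 hneg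
    filter_upwards [e2] with p hp2 hp
    rcases hp with (⟨h4, -⟩ | ⟨h4, h5⟩) | ⟨h4, h5⟩
    · have : x < p.1 := h4
      have : 0 ≤ p.2 := not_lt.1 hp2
      change x < p.1 + p.2
      linarith
    · have : 0 ≤ p.1 := h4.1
      have : x < p.2 := h5
      change x < p.1 + p.2
      linarith
    · have : A < p.1 := h4.1
      have : x - A < p.2 := h5
      change x < p.1 + p.2
      linarith
  rw [measureReal_union hd2 (by measurability), measureReal_union hd1 (by measurability),
    hb1, hb2, hb3] at hsum
  have h4 := hH.tail_pos x
  have h5 := hH.tail_pos (x - A)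
  have h6 : (tail H A - δ) * tail H (x - A) ≤ (tail H A + δ) * tail H x := by nlinarith
  have h7 : tail H A + δ = κ * (tail H A - δ) := by
    rw [hδdef]; field_simp; ring
  rw [h7] at h6
  have h8 : 0 < tail H A - δ := by linarith
  exact le_of_mul_le_mul_left (by linarith) h8

/-- Two independent subexponential variables cannot both be large when their sum exceeds a high
level, up to a small fraction of the tail. -/
lemma IsSubexponential.eventually_both_large_le {H : Measure ℝ} (hH : IsSubexponential H) {A : ℝ}
    (hA : 0 ≤ A) : ∀ᶠ x in atTop,
      (H.prod H).real {p | A < p.1 ∧ A < p.2 ∧ x < p.1 + p.2} ≤ 3 * tail H A * tail H x := by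
  have := hH.isProbabilityMeasure
  -- The tolerance is `tail H A` itself. Removing the two cases of one variable in `[0, A]` and the
  -- other above `x` leaves `(2 + tail H A) - 2 * (1 - tail H A) = 3 * tail H A` times the tail.
  filter_upwards [hH.eventually_conv_le (hH.tail_pos A), eventually_ge_atTop A] with x h1 h3
  have hb2 : (H.prod H).real (Icc 0 A ×ˢ Ioi x) = (1 - tail H A) * tail H x := by
    rw [measureReal_prod_prod, hH.real_Icc_zero hA]; rfl
  have hb1 : (H.prod H).real (Ioi x ×ˢ Icc 0 A) = (1 - tail H A) * tail H x := by
    rw [measureReal_prod_prod, hH.real_Icc_zero hA, mul_comm]; rfl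
  have hd1 : Disjoint (Ioi x ×ˢ Icc 0 A) (Icc 0 A ×ˢ Ioi x) :=
    Disjoint.set_prod_left (disjoint_left.2 fun y hy hy' => by
      have h4 : x < y := hy
      have h5 : y ≤ A := hy'.2
      linarith) _ _
  have hd2 : Disjoint (Ioi x ×ˢ Icc 0 A ∪ Icc 0 A ×ˢ Ioi x)
      {p : ℝ × ℝ | A < p.1 ∧ A < p.2 ∧ x < p.1 + p.2} := by
    rw [disjoint_union_left]
    exact ⟨disjoint_left.2 fun p hp hp' => absurd hp.2.2 (not_le.2 hp'.2.1),
      disjoint_left.2 fun p hp hp' => absurd hp.1.2 (not_le.2 hp'.1)⟩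
  have hmeas : MeasurableSet {p : ℝ × ℝ | A < p.1 ∧ A < p.2 ∧ x < p.1 + p.2} :=
    (measurableSet_lt measurable_const measurable_fst).inter
      ((measurableSet_lt measurable_const measurable_snd).inter
        (measurableSet_lt measurable_const (measurable_fst.add measurable_snd)))
  have hsum : (H.prod H).real ((Ioi x ×ˢ Icc 0 A ∪ Icc 0 A ×ˢ Ioi x) ∪
      {p : ℝ × ℝ | A < p.1 ∧ A < p.2 ∧ x < p.1 + p.2}) ≤
      (H.prod H).real {p | x < p.1 + p.2} := by
    refine measureReal_mono ?_
    rintro p ((⟨h4, h5⟩ | ⟨h4, h5⟩) | h4)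
    · have : x < p.1 := h4
      have : 0 ≤ p.2 := h5.1
      change x < p.1 + p.2
      linarith
    · have : 0 ≤ p.1 := h4.1
      have : x < p.2 := h5
      change x < p.1 + p.2
      linarith
    · exact h4.2.2
  rw [measureReal_union hd2 hmeas, measureReal_union hd1 (by measurability), hb1, hb2] at hsum
  linarith

/-! ### The integrated tail -/

/-- The mean excess `u ↦ ∫_u^∞ F(v, ∞) dv`. -/
def excess (F : Measure ℝ) (u : ℝ) : ℝ := ∫ v in Ioi u, tail F v

section Excess

variable {F : Measure ℝ} [IsProbabilityMeasure F] (hF0 : F (Iio 0) = 0)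
  (hint : Integrable (fun u : ℝ => u) F)

include hF0 hint

lemma integrableOn_tail (u : ℝ) : IntegrableOn (tail F) (Ioi u) := by
  have h0 : IntegrableOn (tail F) (Ioi 0) := by
    refine ⟨(tail_antitone F).measurable.aestronglyMeasurable, ?_⟩
    have hnn : 0 ≤ᵐ[F] fun u : ℝ => u := by
      filter_upwards [measure_eq_zero_iff_ae_notMem.1 hF0] with u hu using not_lt.1 hu
    have h1 := lintegral_eq_lintegral_meas_lt F hnn aemeasurable_id'
    have h2 : ∫⁻ u, ENNReal.ofReal u ∂F < ∞ := hint.lintegral_lt_top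
    rw [h1] at h2
    refine lt_of_le_of_lt (le_of_eq ?_) h2
    refine setLIntegral_congr_fun measurableSet_Ioi fun t _ => ?_
    simp only [tail, measureReal_def]
    rw [Real.enorm_of_nonneg ENNReal.toReal_nonneg, ENNReal.ofReal_toReal (measure_ne_top _ _)]
    rfl
  rcases le_total 0 u with h | h
  · exact h0.mono_set (Ioi_subset_Ioi h)
  · rw [← Ioc_union_Ioi_eq_Ioi h]
    exact (((tail_antitone F).antitoneOn _).integrableOn_isCompact isCompact_Icc
      |>.mono_set Ioc_subset_Icc_self).union h0

lemma excess_sub {u v : ℝ} : excess F u - excess F v = ∫ t in u..v, tail F t := by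
  have h := intervalIntegral.integral_interval_add_Ioi (integrableOn_tail hF0 hint u)
    (integrableOn_tail hF0 hint v)
  simp only [excess]
  linarith

lemma mul_tail_le_excess {u v : ℝ} (huv : u ≤ v) : (v - u) * tail F v ≤ excess F u := by
  have h1 := excess_sub hF0 hint (u := u) (v := v)
  have h2 : 0 ≤ excess F v := setIntegral_nonneg measurableSet_Ioi fun t _ => tail_nonneg F t
  have h3 : ∫ t in u..v, tail F v ≤ ∫ t in u..v, tail F t :=
    intervalIntegral.integral_mono_on huv (by simp)
      ((tail_antitone F).intervalIntegrable) fun t ht => tail_antitone F ht.2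
  rw [intervalIntegral.integral_const, smul_eq_mul] at h3
  linarith

lemma tendsto_excess : Tendsto (excess F) atTop (𝓝 0) := by
  have h1 := intervalIntegral_tendsto_integral_Ioi 0 (integrableOn_tail hF0 hint 0) tendsto_id
  have h2 : Tendsto (fun v => excess F 0 - ∫ t in (0:ℝ)..v, tail F t) atTop
      (𝓝 (excess F 0 - excess F 0)) := tendsto_const_nhds.sub h1
  rw [sub_self] at h2
  refine h2.congr fun v => ?_
  rw [← excess_sub hF0 hint]
  ring

lemma integratedTail_eq (x : ℝ) : integratedTail F x = min 1 (excess F x) := by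
  have h : ∫⁻ u in Ioi x, F (Ioi u) = ENNReal.ofReal (excess F x) := by
    rw [excess, ofReal_integral_eq_lintegral_ofReal (integrableOn_tail hF0 hint x)
      (Eventually.of_forall fun t => tail_nonneg F t)]
    refine lintegral_congr fun u => ?_
    rw [tail, measureReal_def, ENNReal.ofReal_toReal (measure_ne_top _ _)]
  have h0 : 0 ≤ excess F x := setIntegral_nonneg measurableSet_Ioi fun t _ => tail_nonneg F t
  rw [integratedTail, h, ENNReal.toReal_min ENNReal.one_ne_top ENNReal.ofReal_ne_top,
    ENNReal.toReal_one, ENNReal.toReal_ofReal h0]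

lemma eventually_integratedTail_eq : ∀ᶠ x in atTop, integratedTail F x = excess F x := by
  filter_upwards [(tendsto_excess hF0 hint).eventually (gt_mem_nhds one_pos)] with x hx
  rw [integratedTail_eq hF0 hint, min_eq_right hx.le]

lemma tendsto_integratedTail : Tendsto (integratedTail F) atTop (𝓝 0) :=
  (tendsto_excess hF0 hint).congr' <| by
    filter_upwards [eventually_integratedTail_eq hF0 hint] with x hx using hx.symm

lemma tail_integratedDist {x : ℝ} (hx : 0 ≤ x) :
    tail (integratedDist F) x = integratedTail F x := by
  have h : Tendsto (integratedCDF F) atTop (𝓝 1) := by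
    have h1 : Tendsto (fun x => 1 - integratedTail F x) atTop (𝓝 (1 - 0)) :=
      tendsto_const_nhds.sub (tendsto_integratedTail hF0 hint)
    rw [sub_zero] at h1
    refine h1.congr' ?_
    filter_upwards [eventually_ge_atTop 0] with y hy
    exact (if_neg (not_lt.2 hy)).symm
  have h2 : integratedCDF F x = 1 - integratedTail F x := if_neg (not_lt.2 hx)
  rw [tail, measureReal_def, integratedDist, StieltjesFunction.measure_Ioi _ h, h2, sub_sub_cancel,
    ENNReal.toReal_ofReal (integratedTail_nonneg F x)]

variable (hFs : IsSubexponential (integratedDist F))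

include hFs

lemma integratedTail_pos (x : ℝ) : 0 < integratedTail F x := by
  have h := hFs.tail_pos (max x 0)
  rw [tail_integratedDist hF0 hint (le_max_right _ _)] at h
  exact h.trans_le (integratedTail_antitone F (le_max_left _ _))

lemma eventually_integratedTail_sub_le (A : ℝ) {κ : ℝ} (hκ : 1 < κ) :
    ∀ᶠ x in atTop, integratedTail F (x - A) ≤ κ * integratedTail F x := by
  filter_upwards [hFs.eventually_tail_sub_le A hκ, eventually_ge_atTop 0, eventually_ge_atTop A]
    with x h1 h2 h3
  rwa [tail_integratedDist hF0 hint h2, tail_integratedDist hF0 hint (sub_nonneg.2 h3)] at h1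

lemma eventually_excess_sub_le (A : ℝ) {κ : ℝ} (hκ : 1 < κ) :
    ∀ᶠ x in atTop, excess F (x - A) ≤ κ * integratedTail F x := by
  have h := (tendsto_atTop_add_const_right atTop (-A) tendsto_id).eventually
    (eventually_integratedTail_eq hF0 hint)
  filter_upwards [h, eventually_integratedTail_sub_le hF0 hint hFs A hκ] with x h1 h2
  rw [id, ← sub_eq_add_neg] at h1
  rwa [← h1]

/-- On a window of length `2 / ε` ending at `x - A` the tail is at least `tail F (x - A)`, while the
excess from the start of the window is at most twice the integrated tail at `x`, by long-tailedness.
-/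
lemma eventually_tail_sub_le_integratedTail (A : ℝ) {ε : ℝ} (hε : 0 < ε) :
    ∀ᶠ x in atTop, tail F (x - A) ≤ ε * integratedTail F x := by
  filter_upwards [eventually_excess_sub_le hF0 hint hFs (A + 2 / ε) one_lt_two] with x h1
  have h2 := mul_tail_le_excess hF0 hint (u := x - (A + 2 / ε)) (v := x - A)
    (by have : 0 < 2 / ε := by positivity
        linarith)
  have h3 : x - A - (x - (A + 2 / ε)) = 2 / ε := by ring
  rw [h3] at h2
  have h4 : 2 / ε * tail F (x - A) ≤ 2 * integratedTail F x := h2.trans h1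
  rw [div_mul_eq_mul_div, div_le_iff₀ hε] at h4
  linarith

end Excess

/-! ### Sequences of independent variables -/

/-- The sequence `x n, x (n + 1), …`. -/
def shift (n : ℕ) (x : ℕ → ℝ) : ℕ → ℝ := fun j => x (n + j)

/-- The sequence `h 0, …, h (n - 1), t 0, t 1, …`. -/
def splice (n : ℕ) (h t : ℕ → ℝ) : ℕ → ℝ := fun j => if j < n then h j else t (j - n)

lemma splice_of_lt {n j : ℕ} (hj : j < n) (h t : ℕ → ℝ) : splice n h t j = h j := if_pos hj

@[simp] lemma splice_self (n : ℕ) (h t : ℕ → ℝ) : splice n h t n = t 0 := by simp [splice]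

@[simp] lemma shift_splice (n : ℕ) (h t : ℕ → ℝ) : shift n (splice n h t) = t := by
  funext j; simp [shift, splice]

lemma shift_shift (n k : ℕ) (x : ℕ → ℝ) : shift n (shift k x) = shift (k + n) x := by
  funext j; simp [shift, add_assoc]

@[simp] lemma shift_zero (x : ℕ → ℝ) : shift 0 x = x := by
  funext j; simp [shift]

@[fun_prop] lemma measurable_shift (n : ℕ) : Measurable (shift n) :=
  measurable_pi_lambda _ fun j => measurable_pi_apply (n + j)

lemma measurable_splice (n : ℕ) : Measurable fun p : (ℕ → ℝ) × (ℕ → ℝ) => splice n p.1 p.2 := by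
  refine measurable_pi_lambda _ fun j => ?_
  by_cases hj : j < n
  · simp only [splice, hj, if_true]; fun_prop
  · simp only [splice, hj, if_false]; fun_prop

/-- The law of a sequence of independent random variables with law `F`. -/
abbrev seqLaw (F : Measure ℝ) : Measure (ℕ → ℝ) := Measure.infinitePi fun _ : ℕ => F

section SeqLaw

variable (F : Measure ℝ) [IsProbabilityMeasure F]

/-- Every independence argument below goes through this map: an event determined by the first `n`
coordinates sees only the first factor, and the shifted sequence is the second. -/
lemma measurePreserving_splice (n : ℕ) :
    MeasurePreserving (fun p : (ℕ → ℝ) × (ℕ → ℝ) => splice n p.1 p.2)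
      ((seqLaw F).prod (seqLaw F)) (seqLaw F) := by
  refine ⟨measurable_splice n, Measure.eq_infinitePi _ fun s t ht => ?_⟩
  have hpre : (fun p : (ℕ → ℝ) × (ℕ → ℝ) => splice n p.1 p.2) ⁻¹' Set.pi s t =
      Set.pi (s.filter (· < n) : Finset ℕ) t ×ˢ
        Set.pi ((s.filter (¬ · < n)).image (· - n) : Finset ℕ) fun i => t (n + i) := by
    ext ⟨h, u⟩
    simp only [mem_preimage, Set.mem_pi, Finset.mem_coe, mem_prod, Finset.mem_filter,
      Finset.mem_image, forall_exists_index, and_imp]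
    constructor
    · refine fun H => ⟨fun i hi hin => ?_, fun i j hj hjn hji => ?_⟩
      · have := H i hi
        rwa [splice_of_lt hin] at this
      · have := H j hj
        subst hji
        rw [splice, if_neg hjn] at this
        rwa [Nat.add_sub_cancel' (not_lt.1 hjn)]
    · rintro ⟨H1, H2⟩ i hi
      by_cases hin : i < n
      · rw [splice_of_lt hin]; exact H1 i hi hin
      · have := H2 (i - n) i hi hin rfl
        rw [Nat.add_sub_cancel' (not_lt.1 hin)] at this
        rwa [splice, if_neg hin]
  rw [Measure.map_apply (measurable_splice n)
      (MeasurableSet.pi s.countable_toSet fun i _ => ht i), hpre, Measure.prod_prod,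
    Measure.infinitePi_pi _ fun i _ => ht i, Measure.infinitePi_pi _ fun i _ => ht (n + i),
    Finset.prod_image, ← Finset.prod_filter_mul_prod_filter_not s (· < n)]
  · congr 1
    refine Finset.prod_congr rfl fun i hi => ?_
    rw [Nat.add_sub_cancel' (not_lt.1 (Finset.mem_filter.1 hi).2)]
  · intro i hi j hj hij
    simp only [Finset.coe_filter, mem_ofPred_eq, not_lt] at hi hj
    dsimp only at hij
    omega

lemma real_splice {D : Set (ℕ → ℝ)} (hD : MeasurableSet D) (n : ℕ) :
    (seqLaw F).real D = ((seqLaw F).prod (seqLaw F)).real {p | splice n p.1 p.2 ∈ D} :=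
  ((measurePreserving_splice F n).measureReal_preimage hD.nullMeasurableSet).symm

lemma real_coord_gt (n : ℕ) (u : ℝ) : (seqLaw F).real {x | u < x n} = tail F u :=
  (measurePreserving_eval_infinitePi (fun _ : ℕ => F) n).measureReal_preimage
    measurableSet_Ioi.nullMeasurableSet

/-- Independence of the first `n` coordinates and the next one. -/
lemma real_head_inter_coord {B : Set (ℕ → ℝ)} (hB : MeasurableSet B) (n : ℕ)
    (hdep : ∀ h t, splice n h t ∈ B ↔ h ∈ B) (u : ℝ) :
    (seqLaw F).real (B ∩ {x | u < x n}) = (seqLaw F).real B * tail F u := by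
  have hm : MeasurableSet {x : ℕ → ℝ | u < x n} :=
    measurableSet_lt measurable_const (measurable_pi_apply n)
  rw [real_splice F (hB.inter hm) n, ← real_coord_gt F 0 u, ← measureReal_prod_prod]
  congr 1
  ext ⟨h, t⟩
  simp [hdep]

/-- Partial sums of independent variables stay below a line of slope larger than the mean, with
high probability. -/
lemma exists_sum_le_line {f : ℝ → ℝ} (hf : Measurable f) (hfi : Integrable f F) {c : ℝ}
    (hc : ∫ u, f u ∂F < c) {δ : ℝ} (hδ : 0 < δ) :
    ∃ C : ℝ, 0 ≤ C ∧
      (seqLaw F).real {x | ∃ i, C + c * i < ∑ j ∈ Finset.range i, f (x j)} ≤ δ := by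
  have hmp := measurePreserving_eval_infinitePi (fun _ : ℕ => F)
  have hslln : ∀ᵐ x ∂(seqLaw F), Tendsto
      (fun n : ℕ => (∑ i ∈ Finset.range n, f (x i)) / n) atTop (𝓝 (∫ u, f u ∂F)) := by
    have h := strong_law_ae_real (μ := seqLaw F) (fun n x => f (x n))
      ((hmp 0).integrable_comp_of_integrable hfi)
      (fun i j hij => (iIndepFun_infinitePi (P := fun _ : ℕ => F) (X := fun _ => f)
        fun _ => hf).indepFun hij)
      (fun i => ⟨(hf.comp (measurable_pi_apply i)).aemeasurable,
        (hf.comp (measurable_pi_apply 0)).aemeasurable, by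
          have e : ∀ k : ℕ, (seqLaw F).map (fun x => f (x k)) = F.map f := fun k => by
            conv_rhs => rw [← (hmp k).map_eq, Measure.map_map hf (hmp k).measurable]
            rfl
          rw [e, e]⟩)
    have e : ∫ x, f (x 0) ∂(seqLaw F) = ∫ u, f u ∂F := by
      conv_rhs => rw [← (hmp 0).map_eq]
      rw [integral_map (hmp 0).measurable.aemeasurable hf.aestronglyMeasurable]
    rwa [e] at h
  have hbdd : ∀ᵐ x ∂(seqLaw F), ∃ C : ℕ, ∀ i : ℕ,
      ∑ j ∈ Finset.range i, f (x j) ≤ C + c * i := by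
    filter_upwards [hslln] with x hx
    obtain ⟨N, hN⟩ := eventually_atTop.1 (hx.eventually (gt_mem_nhds hc))
    obtain ⟨C, hC⟩ := exists_nat_ge
      (∑ i ∈ Finset.range (N + 1), |∑ j ∈ Finset.range i, f (x j) - c * i|)
    refine ⟨C, fun i => ?_⟩
    rcases le_or_gt i N with hi | hi
    · have h1 := Finset.single_le_sum (f := fun i : ℕ =>
        |∑ j ∈ Finset.range i, f (x j) - c * i|) (fun _ _ => abs_nonneg _)
        (Finset.mem_range.2 (Nat.lt_succ_of_le hi))
      have h2 := le_abs_self (∑ j ∈ Finset.range i, f (x j) - c * i)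
      linarith
    · have h1 := hN i hi.le
      have hi0 : (0 : ℝ) < i := by exact_mod_cast (Nat.zero_le N).trans_lt hi
      rw [div_lt_iff₀ hi0] at h1
      have : (0 : ℝ) ≤ C := Nat.cast_nonneg _
      linarith
  have hmeas : ∀ C : ℕ, MeasurableSet
      {x : ℕ → ℝ | ∃ i : ℕ, (C : ℝ) + c * i < ∑ j ∈ Finset.range i, f (x j)} := by
    intro C
    simp only [ofPred_exists]
    exact MeasurableSet.iUnion fun i => measurableSet_lt measurable_const
      (Finset.measurable_sum _ fun j _ => hf.comp (measurable_pi_apply j))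
  -- The events decrease in `C`, and by the strong law almost every path eventually leaves them, so
  -- continuity from above gives a suitable `C`.
  have hlim := tendsto_measure_iInter_atTop (μ := seqLaw F) (fun C => (hmeas C).nullMeasurableSet)
    (fun C D hCD x hx => by
      obtain ⟨i, hi⟩ := hx
      have : (C : ℝ) ≤ D := by exact_mod_cast hCD
      exact ⟨i, by linarith⟩) ⟨0, measure_ne_top _ _⟩
  have h0 : (seqLaw F) (⋂ C : ℕ,
      {x : ℕ → ℝ | ∃ i : ℕ, (C : ℝ) + c * i < ∑ j ∈ Finset.range i, f (x j)}) = 0 := by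
    rw [measure_eq_zero_iff_ae_notMem]
    filter_upwards [hbdd] with x hx hmem
    obtain ⟨C, hC⟩ := hx
    obtain ⟨i, hi⟩ := mem_iInter.1 hmem C
    exact absurd (hC i) (not_le.2 hi)
  rw [h0] at hlim
  obtain ⟨C, hC⟩ := (hlim.eventually
    (ge_mem_nhds (ENNReal.ofReal_pos.2 hδ))).exists
  exact ⟨C, Nat.cast_nonneg C, ENNReal.toReal_le_of_le_ofReal hδ.le hC⟩

end SeqLaw

/-! ### Reflected random walks -/

/-- The walk with steps `f (x 0), f (x 1), …`. -/
def walk (f : ℝ → ℝ) (N : ℕ) (x : ℕ → ℝ) : ℝ := ∑ j ∈ Finset.range N, f (x j)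

/-- The walk reflected at `0`, started at `u`, after the `N` steps
`f (x (N - 1)), …, f (x 1), f (x 0)`, in this order. -/
def reflected (f : ℝ → ℝ) (u : ℝ) : ℕ → (ℕ → ℝ) → ℝ
  | 0, _ => u
  | N + 1, x => max (reflected f u N (shift 1 x) + f (x 0)) 0

@[simp] lemma walk_zero (f : ℝ → ℝ) (x : ℕ → ℝ) : walk f 0 x = 0 := by simp [walk]

lemma walk_succ (f : ℝ → ℝ) (N : ℕ) (x : ℕ → ℝ) : walk f (N + 1) x = walk f N x + f (x N) :=
  Finset.sum_range_succ _ _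

lemma walk_succ' (f : ℝ → ℝ) (N : ℕ) (x : ℕ → ℝ) :
    walk f (N + 1) x = walk f N (shift 1 x) + f (x 0) := by
  rw [walk, Finset.sum_range_succ', walk]
  simp [shift, add_comm]

lemma walk_add (f : ℝ → ℝ) (n k : ℕ) (x : ℕ → ℝ) :
    walk f (n + k) x = walk f n x + walk f k (shift n x) :=
  Finset.sum_range_add _ _ _

lemma walk_splice (f : ℝ → ℝ) {n i : ℕ} (hi : i ≤ n) (h t : ℕ → ℝ) :
    walk f i (splice n h t) = walk f i h :=
  Finset.sum_congr rfl fun j hj => by rw [splice_of_lt ((Finset.mem_range.1 hj).trans_le hi)]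

lemma measurable_walk {f : ℝ → ℝ} (hf : Measurable f) (N : ℕ) : Measurable (walk f N) :=
  Finset.measurable_sum _ fun j _ => hf.comp (measurable_pi_apply j)

lemma measurable_reflected {f : ℝ → ℝ} (hf : Measurable f) (u : ℝ) (N : ℕ) :
    Measurable (reflected f u N) := by
  induction N with
  | zero => exact measurable_const
  | succ N ih =>
    exact ((ih.comp (measurable_shift 1)).add (hf.comp (measurable_pi_apply 0))).max
      measurable_const

lemma reflected_nonneg (f : ℝ → ℝ) {u : ℝ} (hu : 0 ≤ u) (N : ℕ) (x : ℕ → ℝ) :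
    0 ≤ reflected f u N x := by
  cases N with
  | zero => exact hu
  | succ N => exact le_max_right _ _

/-- With the steps applied in reversed order, the reflected walk is the maximum of `u + walk f N x`
and of the partial sums `walk f i x` with `i < N`, all read on the same sequence. -/
lemma reflected_le {f : ℝ → ℝ} {u B : ℝ} {N : ℕ} {x : ℕ → ℝ} (h1 : u + walk f N x ≤ B)
    (h2 : ∀ i < N, walk f i x ≤ B) : reflected f u N x ≤ B := by
  induction N generalizing x B with
  | zero => simpa [reflected] using h1
  | succ N ih =>
    refine max_le ?_ (by simpa using h2 0 N.succ_pos)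
    have := ih (x := shift 1 x) (B := B - f (x 0)) (by rw [walk_succ'] at h1; linarith)
      (fun i hi => by
        have := h2 (i + 1) (by omega)
        rw [walk_succ'] at this; linarith)
    linarith

lemma walk_le_reflected (f : ℝ → ℝ) {N i : ℕ} (hi : i ≤ N) (x : ℕ → ℝ) :
    walk f i x ≤ reflected f 0 N x := by
  induction i generalizing N x with
  | zero => simpa using reflected_nonneg f le_rfl N x
  | succ i ih =>
    obtain ⟨N, rfl⟩ : ∃ N', N = N' + 1 := ⟨N - 1, by omega⟩
    rw [walk_succ', reflected]
    exact (add_le_add_left (ih (by omega) _) _).trans (le_max_left _ _)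

lemma exists_lt_walk {f : ℝ → ℝ} {N : ℕ} {x : ℕ → ℝ} {v : ℝ}
    (h : v < reflected f 0 N x) : ∃ i ≤ N, v < walk f i x := by
  by_contra! H
  exact absurd (reflected_le (by simpa using H N le_rfl) fun i hi => H i hi.le) (not_le.2 h)

/-! ### Multiserver queues -/

section Queue

variable {m : ℕ} [NeZero m]

omit [NeZero m] in
lemma exists_rearrange_eq (v : Fin m → ℝ) (i : Fin m) : ∃ j, rearrange v j = v i :=
  ⟨(Tuple.sort v).symm i, by simp [rearrange]⟩

lemma rearrange_zero_le (v : Fin m → ℝ) (i : Fin m) : rearrange v 0 ≤ v i := by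
  obtain ⟨j, hj⟩ := exists_rearrange_eq v i
  rw [← hj]
  exact Tuple.monotone_sort v (Fin.zero_le j)

omit [NeZero m] in
lemma sum_rearrange (v : Fin m → ℝ) : ∑ i, rearrange v i = ∑ i, v i :=
  Equiv.sum_comp (Tuple.sort v) v

/-- The largest index. -/
def topIndex (m : ℕ) [NeZero m] : Fin m := ⟨m - 1, Nat.sub_lt (NeZero.pos m) one_pos⟩

lemma le_rearrange_topIndex (v : Fin m → ℝ) (i : Fin m) : v i ≤ rearrange v (topIndex m) := by
  obtain ⟨j, hj⟩ := exists_rearrange_eq v i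
  rw [← hj]
  exact Tuple.monotone_sort v (Fin.le_def.2 (by simp only [topIndex]; omega))

/-- One step of the Kiefer–Wolfowitz recursion, before reordering. -/
def serve (a : ℝ) (w : Fin m → ℝ) (s : ℝ) (i : Fin m) : ℝ :=
  max (w i + (Pi.single 0 s : Fin m → ℝ) i - a) 0

/-- One step of the Kiefer–Wolfowitz recursion. -/
def kwStep (a : ℝ) (w : Fin m → ℝ) (s : ℝ) : Fin m → ℝ := rearrange (serve a w s)

/-- The workload vector that results from `w` after the arrivals of customers with service times
`x (N - 1), …, x 1, x 0`, in this order. -/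
def state (a : ℝ) (w : Fin m → ℝ) : ℕ → (ℕ → ℝ) → Fin m → ℝ
  | 0, _ => w
  | N + 1, x => kwStep a (state a w N (shift 1 x)) (x 0)

/-- The maximal dater of the queue started empty with the arrivals `x N, …, x 1, x 0`. -/
def pastDater (m : ℕ) [NeZero m] (a : ℝ) (N : ℕ) (x : ℕ → ℝ) : ℝ :=
  max (state (m := m) a 0 N (shift 1 x) 0 + x 0) (state (m := m) a 0 N (shift 1 x) (topIndex m))

variable {a : ℝ}

lemma workload_eq_state {s x : ℕ → ℝ} {N : ℕ} (h : ∀ k < N, s k = x (N - 1 - k)) :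
    workload (m := m) a s N = state a 0 N x := by
  induction N generalizing x with
  | zero => rfl
  | succ N ih =>
    have h0 : s N = x 0 := by rw [h N N.lt_succ_self]; congr 1; omega
    rw [state, ← ih fun k hk => ?_, ← h0]
    · rfl
    · rw [h k (by omega), shift]; congr 1; omega

lemma dater_eq_pastDater {s x : ℕ → ℝ} {N : ℕ} (h : ∀ k ≤ N, s k = x (N - k)) :
    dater m a s N = pastDater m a N x := by
  have h1 : workload (m := m) a s N = state a 0 N (shift 1 x) :=
    workload_eq_state fun k hk => by rw [h k hk.le, shift]; congr 1; omega
  rw [dater, pastDater, h1, h N le_rfl, Nat.sub_self]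
  rfl

lemma state_add (w : Fin m → ℝ) (n k : ℕ) (x : ℕ → ℝ) :
    state a w (n + k) x = state a (state a w k (shift n x)) n x := by
  induction n generalizing x with
  | zero => simp [state]
  | succ n ih =>
    rw [Nat.add_right_comm, state, ih, state, shift_shift, add_comm 1 n]

lemma serve_nonneg (w : Fin m → ℝ) (s : ℝ) (i : Fin m) : 0 ≤ serve a w s i := le_max_right _ _

lemma kwStep_nonneg (w : Fin m → ℝ) (s : ℝ) (i : Fin m) : 0 ≤ kwStep a w s i :=
  serve_nonneg _ _ _

lemma kwStep_zero_le (w : Fin m → ℝ) (s : ℝ) (i : Fin m) : kwStep a w s 0 ≤ kwStep a w s i :=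
  rearrange_zero_le _ _

lemma kwStep_le {w : Fin m → ℝ} {s B : ℝ} (h : ∀ i, serve a w s i ≤ B) (i : Fin m) :
    kwStep a w s i ≤ B :=
  h _

lemma serve_zero (w : Fin m → ℝ) (s : ℝ) : serve a w s 0 = max (w 0 + s - a) 0 := by
  simp [serve]

lemma serve_of_ne (w : Fin m → ℝ) (s : ℝ) {i : Fin m} (hi : i ≠ 0) :
    serve a w s i = max (w i - a) 0 := by
  simp [serve, hi]

lemma sub_le_serve (w : Fin m → ℝ) {s : ℝ} (hs : 0 ≤ s) (i : Fin m) :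
    w i - a ≤ serve a w s i := by
  rcases eq_or_ne i 0 with rfl | hi
  · rw [serve_zero]; exact le_max_of_le_left (by linarith)
  · rw [serve_of_ne _ _ hi]; exact le_max_left _ _

lemma sum_single_sub (w : Fin m → ℝ) (s : ℝ) :
    ∑ i, (w i + (Pi.single 0 s : Fin m → ℝ) i - a) = ∑ i, w i + s - m * a := by
  rw [Finset.sum_sub_distrib, Finset.sum_add_distrib, Finset.sum_pi_single']
  simp

lemma sum_kwStep_ge (w : Fin m → ℝ) (s : ℝ) : ∑ i, w i + s - m * a ≤ ∑ i, kwStep a w s i := by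
  rw [kwStep, sum_rearrange, ← sum_single_sub]
  exact Finset.sum_le_sum fun i _ => le_max_left _ _

/-- The total workload after a step, either when all servers stay busy or when one gets idle. -/
lemma sum_kwStep_cases (w : Fin m → ℝ) (s : ℝ) :
    ∑ i, kwStep a w s i = ∑ i, w i + s - m * a ∨ kwStep a w s 0 = 0 := by
  by_cases h : ∃ i, w i + (Pi.single 0 s : Fin m → ℝ) i - a < 0
  · obtain ⟨i, hi⟩ := h
    right
    refine le_antisymm ((rearrange_zero_le _ i).trans ?_) (kwStep_nonneg _ _ _)
    exact (max_eq_right hi.le).le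
  · push Not at h
    left
    rw [kwStep, sum_rearrange, ← sum_single_sub]
    exact Finset.sum_congr rfl fun i _ => max_eq_left (h i)

lemma state_nonneg {w : Fin m → ℝ} (hw : ∀ i, 0 ≤ w i) (N : ℕ) (x : ℕ → ℝ) (i : Fin m) :
    0 ≤ state a w N x i := by
  cases N with
  | zero => exact hw i
  | succ N => exact kwStep_nonneg _ _ _

lemma state_zero_le {w : Fin m → ℝ} (hw : ∀ i, w 0 ≤ w i) (N : ℕ) (x : ℕ → ℝ) (i : Fin m) :
    state a w N x 0 ≤ state a w N x i := by
  cases N with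
  | zero => exact hw i
  | succ N => exact kwStep_zero_le _ _ _

/-- Within one step no residual workload falls by more than `a`, so the dater is controlled by the
coordinates after the step. -/
lemma pastDater_le_of_state (N : ℕ) {x : ℕ → ℝ} (hx : 0 ≤ x 0) {B : ℝ}
    (h : ∀ i, state (m := m) a 0 (N + 1) x i ≤ B) : pastDater m a N x ≤ B + a := by
  have h1 : ∀ i, serve a (state (m := m) a 0 N (shift 1 x)) (x 0) i ≤ B := fun i =>
    (le_rearrange_topIndex _ i).trans (h _)
  refine max_le ?_ ?_
  · have := h1 0
    rw [serve_zero] at this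
    linarith [le_max_left (state (m := m) a 0 N (shift 1 x) 0 + x 0 - a) 0]
  · linarith [h1 (topIndex m), sub_le_serve (a := a) (state (m := m) a 0 N (shift 1 x)) hx
      (topIndex m)]

/-! #### Lower bounds -/

/-- The server that took the customer loses at most `a` per arrival. Reordering loses track of that
server, but its load is always bounded by the largest coordinate. -/
lemma le_state_topIndex {x : ℕ → ℝ} (hx : ∀ j, 0 ≤ x j) {n N : ℕ} (hn : n < N) :
    x n - (n + 1) * a ≤ state (m := m) a 0 N x (topIndex m) := by
  induction n generalizing N x with
  | zero =>
    obtain ⟨N, rfl⟩ : ∃ N', N = N' + 1 := ⟨N - 1, by omega⟩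
    refine le_trans ?_ (le_rearrange_topIndex _ 0)
    rw [serve_zero]
    have := state_nonneg (m := m) (a := a) (w := 0) (fun _ => le_rfl) N (shift 1 x) 0
    refine le_max_of_le_left ?_
    push_cast
    linarith
  | succ n ih =>
    obtain ⟨N, rfl⟩ : ∃ N', N = N' + 1 := ⟨N - 1, by omega⟩
    refine le_trans ?_ (le_rearrange_topIndex _ (topIndex m))
    refine le_trans ?_ (sub_le_serve _ (hx 0) _)
    have := ih (x := shift 1 x) (fun j => hx _) (N := N) (by omega)
    have e : shift 1 x n = x (n + 1) := by rw [shift, add_comm]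
    rw [e] at this
    push_cast
    linarith

lemma le_sum_state (x : ℕ → ℝ) {n N : ℕ} (hn : n ≤ N) :
    walk id n x - n * (m * a) ≤ ∑ i, state (m := m) a 0 N x i := by
  induction n generalizing N x with
  | zero =>
    simp only [walk_zero, CharP.cast_eq_zero, zero_mul, sub_zero]
    exact Finset.sum_nonneg fun i _ => state_nonneg (fun _ => le_rfl) _ _ _
  | succ n ih =>
    obtain ⟨N, rfl⟩ : ∃ N', N = N' + 1 := ⟨N - 1, by omega⟩
    have h1 := ih (shift 1 x) (N := N) (by omega)
    have h2 := sum_kwStep_ge (a := a) (state (m := m) a 0 N (shift 1 x)) (x 0)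
    rw [walk_succ']
    push_cast
    refine le_trans ?_ h2
    simp only [id]
    linarith

/-- The customer that arrived `n` steps ago may still be in the system. -/
lemma le_pastDater {x : ℕ → ℝ} (hx : ∀ j, 0 ≤ x j) {n N : ℕ} (hn : n ≤ N) :
    x n - n * a ≤ pastDater m a N x := by
  cases n with
  | zero =>
    refine le_max_of_le_left ?_
    have := state_nonneg (m := m) (a := a) (w := 0) (fun _ => le_rfl) N (shift 1 x) 0
    simpa using this
  | succ n =>
    refine le_max_of_le_right ?_
    have := le_state_topIndex (m := m) (a := a) (x := shift 1 x) (fun j => hx _) (n := n) (N := N)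
      (by omega)
    have e : shift 1 x n = x (n + 1) := by rw [shift, add_comm]
    rw [e] at this
    exact_mod_cast this

/-- The total work present is at most `m` times the maximal dater. -/
lemma walk_le_mul_pastDater (x : ℕ → ℝ) {n N : ℕ} (hn : n ≤ N) :
    walk id (n + 1) x - n * (m * a) ≤ m * pastDater m a N x := by
  have h1 := le_sum_state (m := m) (a := a) (shift 1 x) hn
  set w := state (m := m) a 0 N (shift 1 x) with hw
  have h2 : ∑ i, (w i + (Pi.single 0 (x 0) : Fin m → ℝ) i) ≤ ∑ _i : Fin m, pastDater m a N x := by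
    refine Finset.sum_le_sum fun i _ => ?_
    rcases eq_or_ne i 0 with rfl | hi
    · rw [Pi.single_eq_same]; exact le_max_left _ _
    · have hle : w i ≤ w (topIndex m) := by
        cases N with
        | zero => simp [hw, state]
        | succ N => exact Tuple.monotone_sort _ (Fin.le_def.2 (by simp only [topIndex]; omega))
      rw [Pi.single_eq_of_ne hi, add_zero]; exact hle.trans (le_max_right _ _)
  rw [Finset.sum_add_distrib, Finset.sum_pi_single'] at h2
  simp only [Finset.mem_univ, if_true, Finset.sum_const, Finset.card_univ, Fintype.card_fin,
    nsmul_eq_mul] at h2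
  rw [walk_succ']
  simp only [id]
  linarith

/-! #### A potential that dominates the workload -/

/-- The increments of a random walk that, reflected at `0`, dominates the workload. -/
def potInc (m : ℕ) (a T s : ℝ) : ℝ := max (s - T) 0 + min s T / m - a

/-- The level `U` dominates the workload vector `w`. -/
structure Dominates (T U : ℝ) (w : Fin m → ℝ) : Prop where
  zero_le : ∀ i, w 0 ≤ w i
  le : ∀ i, w i ≤ U + m * T
  sum_le : ∑ i, w i ≤ m * U + (m - 1) * (m * T)

lemma one_le_cast : (1 : ℝ) ≤ m := by exact_mod_cast NeZero.one_le

/-- The service time splits as `max (s - T) 0 + min s T`: the excess raises the level fully, the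
truncated part only by its share `1 / m`. The sum bound keeps the smallest coordinate, hence the
average, below `U + (m - 1) * T`, so a new service of truncated size at most `T` fits under `U + m *
T`. The sum bound survives in turn: with all servers busy the total changes by `s - m * a`, and with
an idle server only `m - 1` coordinates remain, each at most `U + m * T` for the new level. -/
lemma Dominates.step {T U s : ℝ} (hT : 0 ≤ T) (hs : 0 ≤ s) {w : Fin m → ℝ}
    (h : Dominates T U w) : Dominates T (max (U + potInc m a T s) 0) (kwStep a w s) := by
  have hm := one_le_cast (m := m)
  have hmT : 0 ≤ m * T := by positivity
  have hmin : 0 ≤ min s T / m := by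
    have : 0 ≤ min s T := le_min hs hT
    positivity
  have hmm : m * (min s T / m) = min s T := by field_simp
  set U' := max (U + potInc m a T s) 0 with hU'
  have hU1 : U + (max (s - T) 0 + min s T / m - a) ≤ U' := le_max_left _ _
  have hU0 : 0 ≤ U' := le_max_right _ _
  have hw0 : w 0 ≤ U + (m - 1) * T := by
    have h1 : ∑ _i : Fin m, w 0 ≤ ∑ i, w i := Finset.sum_le_sum fun i _ => h.zero_le i
    rw [Finset.sum_const, Finset.card_univ, Fintype.card_fin, nsmul_eq_mul] at h1
    have h2 := h.sum_le
    have h3 : (m : ℝ) * w 0 ≤ m * (U + (m - 1) * T) := by linarith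
    exact le_of_mul_le_mul_left h3 (by linarith)
  have hmax : 0 ≤ max (s - T) 0 := le_max_right _ _
  have hsT : s = max (s - T) 0 + min s T := by
    rcases le_total s T with h' | h'
    · rw [max_eq_right (by linarith), min_eq_left h']; ring
    · rw [max_eq_left (by linarith), min_eq_right h']; ring
  have hle : ∀ i, serve a w s i ≤ U' + m * T := by
    intro i
    rcases eq_or_ne i 0 with rfl | hi
    · rw [serve_zero]
      refine max_le ?_ (by linarith)
      have := min_le_right s T
      linarith
    · rw [serve_of_ne _ _ hi]
      refine max_le ?_ (by linarith)
      have := h.le i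
      linarith
  refine ⟨kwStep_zero_le _ _, kwStep_le hle, ?_⟩
  rcases sum_kwStep_cases (a := a) w s with h1 | h1
  · rw [h1]
    have h2 := h.sum_le
    have h3 : (m : ℝ) * (U + (max (s - T) 0 + min s T / m - a)) ≤ m * U' :=
      mul_le_mul_of_nonneg_left hU1 (by linarith)
    have h4 : max (s - T) 0 ≤ m * max (s - T) 0 := le_mul_of_one_le_left hmax hm
    have h5 : (m : ℝ) * (U + (max (s - T) 0 + min s T / m - a)) =
      m * U + m * max (s - T) 0 + m * (min s T / m) - m * a := by ring
    linarith
  · rw [← Finset.add_sum_erase _ _ (Finset.mem_univ 0), h1, zero_add]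
    have h2 := Finset.sum_le_card_nsmul (Finset.univ.erase (0 : Fin m)) (kwStep a w s)
      (U' + m * T) fun i _ => kwStep_le hle i
    rw [Finset.card_erase_of_mem (Finset.mem_univ _), Finset.card_univ, Fintype.card_fin,
      nsmul_eq_mul, Nat.cast_sub NeZero.one_le, Nat.cast_one] at h2
    nlinarith

lemma Dominates.iterate {T U : ℝ} (hT : 0 ≤ T) {w : Fin m → ℝ} (h : Dominates T U w) {x : ℕ → ℝ}
    (hx : ∀ j, 0 ≤ x j) (N : ℕ) :
    Dominates T (reflected (potInc m a T) U N x) (state a w N x) := by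
  induction N generalizing x with
  | zero => exact h
  | succ N ih => exact (ih (x := shift 1 x) fun j => hx _).step hT (hx 0)

lemma dominates_of_le {T U : ℝ} (hT : 0 ≤ T) {w : Fin m → ℝ} (h0 : ∀ i, w 0 ≤ w i)
    (h : ∀ i, w i ≤ U) : Dominates T U w := by
  have hm := one_le_cast (m := m)
  have hmT : 0 ≤ m * T := by positivity
  refine ⟨h0, fun i => (h i).trans (by linarith), ?_⟩
  have h2 := Finset.sum_le_card_nsmul Finset.univ w U fun i _ => h i
  rw [Finset.card_univ, Fintype.card_fin, nsmul_eq_mul] at h2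
  nlinarith

lemma state_le_reflected {T : ℝ} (hT : 0 ≤ T) {x : ℕ → ℝ} (hx : ∀ j, 0 ≤ x j) (N : ℕ)
    (i : Fin m) : state a 0 N x i ≤ reflected (potInc m a T) 0 N x + m * T :=
  ((dominates_of_le hT (fun _ => le_rfl) fun _ => le_rfl).iterate hT hx N).le i

/-! #### The effect of one large service time -/

/-- All servers but one have a workload close to the minimal one, and the exceptional server has
workload about `D` at most, if it is not close to the minimal one, too. -/
structure Balanced (c D : ℝ) (w : Fin m → ℝ) : Prop where
  zero_le : ∀ i, w 0 ≤ w i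
  exceptional : ∃ j, ∀ i, w i ≤ w 0 + c ∨ (i = j ∧ w i ≤ D + c)

lemma balanced_kwStep {c y : ℝ} (hc : 0 ≤ c) (ha : 0 ≤ a) {w : Fin m → ℝ} (hw : ∀ i, w i ≤ c) :
    Balanced c (y - a) (kwStep a w y) := by
  refine ⟨kwStep_zero_le _ _, (Tuple.sort (serve a w y)).symm 0, fun i => ?_⟩
  have h0 := kwStep_nonneg (a := a) w y 0
  rcases eq_or_ne (Tuple.sort (serve a w y) i) 0 with hi | hi
  · have e : kwStep a w y i = max (w 0 + y - a) 0 := by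
      rw [← serve_zero, ← hi]; rfl
    rcases max_cases (w 0 + y - a) 0 with h | h
    · exact Or.inr ⟨by rw [← hi]; simp, by rw [e, h.1]; linarith [hw 0]⟩
    · exact Or.inl (by rw [e, h.1]; linarith)
  · have e : kwStep a w y i = max (w (Tuple.sort (serve a w y) i) - a) 0 := by
      rw [← serve_of_ne (s := y) _ hi]; rfl
    refine Or.inl ?_
    rw [e]
    exact max_le (by linarith [hw (Tuple.sort (serve a w y) i)]) (by linarith)

/-- The smallest coordinate falls by at most `a`, and so does any coordinate that stays positive and
gets no work, which preserves the gap `c`. The coordinate that does get work was the smallest one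
and gains at most `c`. The exceptional coordinate is followed through the sorting permutation. -/
lemma Balanced.step {c D s : ℝ} (hc : 0 ≤ c) (hs : 0 ≤ s) (hsc : s ≤ c)
    {w : Fin m → ℝ} (h : Balanced c D w) : Balanced c (D - a) (kwStep a w s) := by
  obtain ⟨j, hj⟩ := h.exceptional
  refine ⟨kwStep_zero_le _ _, (Tuple.sort (serve a w s)).symm j, fun i => ?_⟩
  set l := Tuple.sort (serve a w s) i with hl
  have h0 : 0 ≤ kwStep a w s 0 := kwStep_nonneg _ _ _
  have h1 : w 0 - a ≤ kwStep a w s 0 := by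
    refine le_trans ?_ (sub_le_serve w hs _)
    linarith [h.zero_le (Tuple.sort (serve a w s) 0)]
  have e : kwStep a w s i = serve a w s l := rfl
  rw [e]
  rcases eq_or_ne l 0 with h2 | h2
  · rw [h2, serve_zero]
    exact Or.inl (max_le (by linarith) (by linarith))
  · rw [serve_of_ne _ _ h2]
    rcases hj l with h3 | ⟨h3, h4⟩
    · exact Or.inl (max_le (by linarith) (by linarith))
    · rcases max_cases (w l - a) 0 with h | h
      · exact Or.inr ⟨by rw [← h3, hl]; simp, by rw [h.1]; linarith⟩
      · exact Or.inl (by rw [h.1]; linarith)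

lemma Balanced.sum_le_of_idle {c D : ℝ} {w : Fin m → ℝ} (h : Balanced c D w) (h0 : w 0 = 0) :
    ∑ i, w i ≤ m * c + max D 0 := by
  obtain ⟨j, hj⟩ := h.exceptional
  have h1 : ∀ i, w i ≤ c + (Pi.single j (max D 0) : Fin m → ℝ) i := by
    intro i
    rcases eq_or_ne i j with rfl | hi
    · rw [Pi.single_eq_same]
      rcases hj i with h2 | ⟨-, h2⟩
      · linarith [le_max_right D 0]
      · linarith [le_max_left D 0]
    · rw [Pi.single_eq_of_ne hi]
      rcases hj i with h2 | ⟨h2, -⟩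
      · linarith
      · exact absurd h2 hi
  refine (Finset.sum_le_sum fun i _ => h1 i).trans ?_
  rw [Finset.sum_add_distrib, Finset.sum_pi_single']
  simp

lemma Balanced.iterate {c D : ℝ} (hc : 0 ≤ c) {k : ℕ} {x : ℕ → ℝ}
    (hx : ∀ j, 0 ≤ x j) (hxc : ∀ j < k, x j ≤ c) {w : Fin m → ℝ} (h : Balanced c D w) :
    Balanced c (D - k * a) (state a w k x) := by
  induction k generalizing x with
  | zero => simpa [state] using h
  | succ k ih =>
    have h1 := (ih (x := shift 1 x) (fun j => hx _) fun j hj => hxc _ (by omega)).step (a := a) hc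
      (hx 0) (hxc 0 k.succ_pos)
    have e : D - ((k + 1 : ℕ) : ℝ) * a = D - k * a - a := by push_cast; ring
    rw [e]
    exact h1

/-- Here `i` counts the arrivals since the last moment with an idle server, or since the start if
there is none. At that moment the total is at most `m * c` plus the residual of the exceptional
server, and afterwards each step changes it by exactly the service time minus `m * a`. -/
lemma Balanced.exists_sum_state_le {c D : ℝ} (hc : 0 ≤ c) {k : ℕ} {x : ℕ → ℝ}
    (hx : ∀ j, 0 ≤ x j) (hxc : ∀ j < k, x j ≤ c) {w : Fin m → ℝ} (h : Balanced c D w)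
    (hsum : ∑ i, w i ≤ m * c + max D 0) :
    ∃ i ≤ k, ∑ l, state a w k x l ≤
      max (D - (k - i) * a) 0 + m * c + walk id i x - m * a * i := by
  induction k generalizing x with
  | zero => exact ⟨0, le_rfl, by simpa [state, add_comm] using hsum⟩
  | succ k ih =>
    rcases sum_kwStep_cases (a := a) (state a w k (shift 1 x)) (x 0) with h1 | h1
    · obtain ⟨i, hi, h2⟩ := ih (x := shift 1 x) (fun j => hx _) fun j hj => hxc _ (by omega)
      refine ⟨i + 1, by omega, ?_⟩
      rw [state, h1, walk_succ']
      push_cast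
      simp only [id]
      rw [show (k : ℝ) + 1 - (i + 1) = k - i by ring]
      linarith
    · refine ⟨0, by omega, ?_⟩
      have h3 := (h.iterate hc hx hxc).sum_le_of_idle h1
      simp only [walk_zero, CharP.cast_eq_zero, sub_zero, mul_zero, add_zero]
      linarith

/-- A bound for the workload `k` arrivals after that of a customer with a large service time `y`,
if the queue was nearly empty at the arrival of that customer. -/
lemma state_after_big_jump_le {b c y Θ : ℝ} (hc : 0 ≤ c) (ha : 0 ≤ a) (hΘ : 0 ≤ Θ)
    (hd : 0 ≤ m * a - b) {k : ℕ} {x : ℕ → ℝ}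
    (hx : ∀ j, 0 ≤ x j) (hxc : ∀ j < k, x j ≤ c) (hsum : ∀ i ≤ k, walk id i x ≤ b * i + Θ)
    {w : Fin m → ℝ} (hw : ∀ i, w i ≤ c) (l : Fin m) :
    state a (kwStep a w y) k x l ≤
      2 * c + Θ + max (max ((y - k * (m * a - b)) / m) (y - k * a)) 0 := by
  have hm := one_le_cast (m := m)
  have hm0 : (0 : ℝ) < m := by linarith
  have hb := balanced_kwStep (m := m) (y := y) hc ha hw
  set M := max (max ((y - k * (m * a - b)) / m) (y - k * a)) 0 with hM
  have hM0 : 0 ≤ M := le_max_right _ _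
  have hM1 : (y - k * (m * a - b)) / m ≤ M := (le_max_left _ _).trans (le_max_left _ _)
  have hM2 : y - k * a ≤ M := (le_max_right _ _).trans (le_max_left _ _)
  have hM1' : y - k * (m * a - b) ≤ m * M := by rwa [div_le_iff₀' hm0] at hM1
  have hmM : M ≤ m * M := le_mul_of_one_le_left hM0 hm
  have hs0 : ∑ i, kwStep a w y i ≤ m * c + max (y - a) 0 := by
    rw [kwStep, sum_rearrange]
    have h1 : ∀ i, serve a w y i ≤ c + (Pi.single 0 (max (y - a) 0) : Fin m → ℝ) i := by
      intro i
      rcases eq_or_ne i 0 with rfl | hi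
      · rw [Pi.single_eq_same, serve_zero]
        refine max_le ?_ (by linarith [le_max_right (y - a) 0])
        linarith [le_max_left (y - a) 0, hw 0]
      · rw [Pi.single_eq_of_ne hi, serve_of_ne _ _ hi]
        exact max_le (by linarith [hw i]) (by linarith)
    refine (Finset.sum_le_sum fun i _ => h1 i).trans ?_
    rw [Finset.sum_add_distrib, Finset.sum_pi_single']
    simp
  obtain ⟨i, hik, hi⟩ := hb.exists_sum_state_le (a := a) hc hx hxc hs0
  have hik' : (i : ℝ) ≤ k := by exact_mod_cast hik
  have hi0 : (0 : ℝ) ≤ i := Nat.cast_nonneg i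
  -- Without the positive part the expression is affine in `i`, so it is bounded by its value at `i
  -- = 0` (own residual of the big customer) or at `i = k` (total work), according to the sign of
  -- the slope.
  have hconv : max (y - a - (k - i) * a) 0 - (m * a - b) * i ≤ m * M := by
    rcases max_cases (y - a - (k - i) * a) 0 with h | h
    · rw [h.1]
      rcases le_total a (m * a - b) with h' | h'
      · nlinarith
      · nlinarith
    · rw [h.1]
      nlinarith
  have hS : ∑ l, state a (kwStep a w y) k x l ≤ m * (c + Θ + M) := by
    have := hsum i hik
    have hmΘ : Θ ≤ m * Θ := le_mul_of_one_le_left hΘ hm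
    nlinarith
  -- The smallest coordinate is at most the average. By balance every other coordinate is within `c`
  -- of it, save the exceptional one, which is bounded by the residual of `y`.
  have hmin : state a (kwStep a w y) k x 0 ≤ c + Θ + M := by
    have h1 : ∑ _i : Fin m, state a (kwStep a w y) k x 0 ≤ ∑ l, state a (kwStep a w y) k x l :=
      Finset.sum_le_sum fun l _ => (hb.iterate hc hx hxc).zero_le l
    rw [Finset.sum_const, Finset.card_univ, Fintype.card_fin, nsmul_eq_mul] at h1
    exact le_of_mul_le_mul_left (h1.trans hS) hm0
  obtain ⟨j, hj⟩ := (hb.iterate hc hx hxc).exceptional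
  rcases hj l with h1 | ⟨-, h1⟩
  · linarith
  · linarith

/-- The level that a large service time has to exceed in order to cause a maximal dater larger than
`u` after `t` further arrivals, in the fluid approximation. -/
def fluidLevel (m : ℕ) (a d u t : ℝ) : ℝ := min (u + t * a) (m * u + t * d)

/-- If the queue is nearly empty at the arrival of a customer and the later service times behave
regularly, then the maximal dater can be large only if the service time of this customer exceeds
the fluid level. -/
lemma exists_pastDater_le {b T α ε A C : ℝ} (ha : 0 < a) (hb : 0 ≤ b) (hd : 0 ≤ m * a - b)
    (hT : 0 ≤ T) (hα : 0 < α) (hε0 : 0 < ε) (hε1 : ε ≤ 1) (hA : 0 ≤ A) (hC : 0 ≤ C) :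
    ∃ C' : ℝ, 0 ≤ C' ∧ ∀ v, C' ≤ v → ∀ N n, n ≤ N → ∀ x : ℕ → ℝ, (∀ j, 0 ≤ x j) →
      (∀ i ≤ n, walk id i x ≤ b * i + (C + α * ε / 8 * i)) →
      (∀ i ≤ n, b * i - (C + α * ε / 8 * i) ≤ walk id i x) →
      (∀ i ≤ n, walk (potInc m a T) i x ≤ C - α * i) →
      reflected (potInc m a T) 0 (N - n) (shift (n + 1) x) ≤ A →
      x n ≤ fluidLevel m a (m * a - b) (v - C') ((1 - ε) * n) → pastDater m a N x ≤ v := by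
  have hm := one_le_cast (m := m)
  have hm0 : (0 : ℝ) < m := by linarith
  have hmT : 0 ≤ m * T := by positivity
  set K := 2 * (A + m * T + b) + 6 * C with hK
  have hK0 : 0 ≤ K := by positivity
  refine ⟨K + C + α + m * T + a, by positivity, fun v hv N n hnN x hx h1 h1' h2 h3 h4 => ?_⟩
  set C' := K + C + α + m * T + a with hC'
  set θ := α * ε / 8 with hθ
  have hθ0 : 0 < θ := by positivity
  have hn0 : (0 : ℝ) ≤ n := Nat.cast_nonneg n
  -- Of the `n` arrivals after the big one, the first `k`, about `(1 - ε) * n`, are compared with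
  -- the fluid path, with an error `6 * θ * n` from fluctuations. The last `q`, about `ε * n`, are
  -- left to the dominating walk, whose drift removes about `α * ε * n = 8 * θ * n` and so absorbs
  -- that error.
  obtain ⟨k, hk⟩ : ∃ k, k = ⌈(1 - ε) * n⌉₊ := ⟨_, rfl⟩
  have hk1 : (1 - ε) * n ≤ k := hk ▸ Nat.le_ceil _
  have hk2 : (k : ℝ) < (1 - ε) * n + 1 := by
    rw [hk]; exact Nat.ceil_lt_add_one (mul_nonneg (by linarith) hn0)
  have hkn : k ≤ n := by
    rw [hk]; refine Nat.ceil_le.2 ?_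
    linarith [mul_nonneg hε0.le hn0]
  obtain ⟨q, rfl⟩ : ∃ q, n = q + k := ⟨n - k, by omega⟩
  obtain ⟨r, rfl⟩ : ∃ r, N = q + k + r := ⟨N - (q + k), by omega⟩
  rw [Nat.add_sub_cancel_left] at h3
  set n := q + k with hn
  have hnq : (n : ℝ) = q + k := by rw [hn]; push_cast; ring
  set y := x n with hy
  set c := A + m * T + b + 2 * C + 2 * (θ * n) with hc
  have hθn : 0 ≤ θ * n := by positivity
  have hc0 : 0 ≤ c := by rw [hc]; linarith
  have hq : ε * n - 1 ≤ q := by linarith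
  have hw : ∀ i, state (m := m) a 0 r (shift (n + 1) x) i ≤ c := fun i => by
    have := state_le_reflected (m := m) (a := a) hT (fun j => hx (n + 1 + j)) r i
    have e : (fun j => x (n + 1 + j)) = shift (n + 1) x := rfl
    rw [e] at this
    rw [hc]
    linarith
  -- One service time is a difference of consecutive partial sums, so the two-sided line bounds
  -- limit it to `b + 2 * C + 2 * θ * n`.
  have hxc : ∀ j < k, shift q x j ≤ c := fun j hj => by
    have e1 := h1 (q + j + 1) (by omega)
    have e2 := h1' (q + j) (by omega)
    rw [walk_succ] at e1
    have e3 : ((q + j + 1 : ℕ) : ℝ) ≤ n := by exact_mod_cast (by omega : q + j + 1 ≤ n)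
    have e4 : shift q x j = x (q + j) := rfl
    simp only [id] at e1
    rw [e4, hc]
    push_cast at e1 e2 e3
    linarith [mul_le_mul_of_nonneg_left e3 hθ0.le]
  have hsum : ∀ i ≤ k, walk id i (shift q x) ≤ b * i + (2 * C + 2 * (θ * n)) := fun i hi => by
    have e1 := h1 (q + i) (by omega)
    have e2 := h1' q (by omega)
    rw [walk_add] at e1
    have e3 : ((q + i : ℕ) : ℝ) ≤ n := by exact_mod_cast (by omega : q + i ≤ n)
    have hi0 : (0 : ℝ) ≤ i := Nat.cast_nonneg i
    push_cast at e1 e2 e3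
    linarith [mul_le_mul_of_nonneg_left e3 hθ0.le, mul_nonneg hθ0.le hi0]
  set w := state a (kwStep a (state (m := m) a 0 r (shift (n + 1) x)) y) k (shift q x) with hwdef
  have hstate : state (m := m) a 0 (n + r + 1) x = state a w q x := by
    rw [show n + r + 1 = q + (k + (r + 1)) by omega, state_add, state_add, hwdef, shift_shift,
      state, shift_shift]
    rfl
  have hwl := state_after_big_jump_le (m := m) (y := y) hc0 ha.le
    (by positivity : 0 ≤ 2 * C + 2 * (θ * n)) hd (fun j => hx (q + j)) hxc hsum hw
  have hv0 : 0 ≤ v - C' := by linarith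
  have hya : y - k * a ≤ v - C' := by
    have := h4.trans (min_le_left _ _)
    linarith [mul_le_mul_of_nonneg_right hk1 ha.le]
  have hyd : (y - k * (m * a - b)) / m ≤ v - C' := by
    rw [div_le_iff₀' hm0]
    have := h4.trans (min_le_right _ _)
    linarith [mul_le_mul_of_nonneg_right hk1 hd]
  set L := K + 6 * (θ * n) + (v - C') with hL
  have hwL : ∀ l, w l ≤ L := fun l => by
    refine (hwl l).trans ?_
    have := max_le (max_le hyd hya) hv0
    rw [hL, hK]
    rw [hc]
    linarith
  have hdom : Dominates T (reflected (potInc m a T) L q x) (state a w q x) :=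
    (dominates_of_le hT (state_zero_le (kwStep_zero_le _ _) _ _) hwL).iterate hT hx q
  have hB : reflected (potInc m a T) L q x ≤ K + C + α + (v - C') := by
    refine reflected_le ?_ fun i hi => ?_
    · have := h2 q (by omega)
      have e1 : α * (ε * n) - α ≤ α * q := by
        linarith [mul_le_mul_of_nonneg_left hq hα.le]
      have e2 : 8 * (θ * n) = α * (ε * n) := by rw [hθ]; ring
      rw [hL]
      linarith
    · have := h2 i (by omega)
      have : 0 ≤ α * i := by positivity
      linarith
  have := pastDater_le_of_state (m := m) (a := a) (n + r) (hx 0)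
    (B := K + C + α + (v - C') + m * T)
    fun i => by rw [hstate]; exact (hdom.le i).trans (by linarith)
  rw [hC'] at this
  linarith

lemma pastDater_le_reflected {T : ℝ} (hT : 0 ≤ T) {x : ℕ → ℝ} (hx : ∀ j, 0 ≤ x j) (N : ℕ) :
    pastDater m a N x ≤ reflected (potInc m a T) 0 (N + 1) x + m * T + a :=
  pastDater_le_of_state N (hx 0) fun i => state_le_reflected hT hx (N + 1) i

/-- A service time larger than the fluid level causes a large maximal dater. -/
lemma lt_pastDater {b ε C v : ℝ} (ha : 0 ≤ a) (hε0 : 0 ≤ ε) (hC : 0 ≤ C)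
    {N n : ℕ} (hn : n ≤ N) {x : ℕ → ℝ} (hx : ∀ j, 0 ≤ x j)
    (h1 : b * n - C - ε * (m * a - b) * n ≤ walk id n x)
    (h2 : fluidLevel m a (m * a - b) (v + C) ((1 + ε) * n) < x n) : v < pastDater m a N x := by
  have hm := one_le_cast (m := m)
  have hn0 : (0 : ℝ) ≤ n := Nat.cast_nonneg n
  -- Below the first line the big customer is itself still present long enough; below the second,
  -- the total work exceeds `m * v`, and the extra `ε * n * d` pays for the fluctuation of the
  -- partial sum.
  rcases min_lt_iff.1 h2 with h | h
  · have h3 := le_pastDater (m := m) (a := a) hx hn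
    have : 0 ≤ ε * n * a := by positivity
    nlinarith
  · have h3 := walk_le_mul_pastDater (m := m) (a := a) x hn
    rw [walk_succ] at h3
    simp only [id] at h3
    have h4 : C ≤ m * C := le_mul_of_one_le_left hC hm
    have h5 : (m : ℝ) * v < m * pastDater m a N x := by nlinarith
    exact lt_of_mul_lt_mul_left h5 (by linarith)

end Queue

/-! ### Comparison of sums and integrals -/

lemma sum_le_add_integral {φ : ℝ → ℝ} (hφ : Antitone φ) (h0 : ∀ t, 0 ≤ φ t)
    (hi : IntegrableOn φ (Ioi 0)) {κ : ℝ} (hκ : 0 < κ) (N : ℕ) :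
    ∑ n ∈ Finset.range N, φ (κ * n) ≤ φ 0 + (∫ t in Ioi 0, φ t) / κ := by
  have hnn : 0 ≤ ∫ t in Ioi 0, φ t := setIntegral_nonneg measurableSet_Ioi fun t _ => h0 t
  have hcomp : Antitone fun t => φ (κ * t) := fun s t h => hφ (mul_le_mul_of_nonneg_left h hκ.le)
  have hint : IntegrableOn (fun t => φ (κ * t)) (Ioi 0) := by
    rw [integrableOn_Ioi_comp_mul_left_iff _ _ hκ, mul_zero]; exact hi
  cases N with
  | zero => simpa using add_nonneg (h0 0) (div_nonneg hnn hκ.le)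
  | succ N =>
    have h1 := (hcomp.antitoneOn (Icc 0 (0 + (N : ℝ)))).sum_le_integral
    have h2 : ∫ t in (0 : ℝ)..(0 + (N : ℝ)), φ (κ * t) ≤ ∫ t in Ioi 0, φ (κ * t) := by
      rw [zero_add, intervalIntegral.integral_of_le (Nat.cast_nonneg N)]
      exact setIntegral_mono_set hint (Eventually.of_forall fun t => h0 _)
        (Eventually.of_forall Ioc_subset_Ioi_self)
    rw [integral_comp_mul_left_Ioi (fun t => φ t) 0 hκ, mul_zero, smul_eq_mul, inv_mul_eq_div] at h2
    rw [Finset.sum_range_succ']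
    simp only [zero_add] at h1 h2
    simp only [CharP.cast_eq_zero, mul_zero]
    linarith

lemma integral_le_sum {φ : ℝ → ℝ} (hφ : Antitone φ) {κ : ℝ} (hκ : 0 < κ) (N : ℕ) :
    (∫ t in (0 : ℝ)..(κ * N), φ t) / κ ≤ ∑ n ∈ Finset.range N, φ (κ * n) := by
  have hcomp : Antitone fun t => φ (κ * t) := fun s t h => hφ (mul_le_mul_of_nonneg_left h hκ.le)
  have h1 := (hcomp.antitoneOn (Icc 0 (0 + (N : ℝ)))).integral_le_sum
  rw [zero_add, intervalIntegral.integral_comp_mul_left _ hκ.ne', mul_zero, smul_eq_mul,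
    inv_mul_eq_div] at h1
  simpa using h1

lemma integral_tail_add (F : Measure ℝ) (u t₀ : ℝ) :
    ∫ t in Ioi t₀, tail F (u + t) = excess F (u + t₀) := by
  rw [excess]
  have h := (measurePreserving_add_left volume u).setIntegral_preimage_emb
    (Homeomorph.addLeft u).measurableEmbedding (tail F) (Ioi (u + t₀))
  rw [← h]
  congr 2
  simp

section SumTail

variable {F : Measure ℝ} [IsProbabilityMeasure F] (hF0 : F (Iio 0) = 0)
  (hint : Integrable (fun u : ℝ => u) F)

include hF0 hint

lemma integrableOn_tail_add (u t₀ : ℝ) : IntegrableOn (fun t => tail F (u + t)) (Ioi t₀) := by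
  have h := (measurePreserving_add_left volume u).integrableOn_comp_preimage
    (Homeomorph.addLeft u).measurableEmbedding (f := tail F) (s := Ioi (u + t₀))
  have h2 := h.2 (integrableOn_tail hF0 hint _)
  have e : (fun t => u + t) ⁻¹' Ioi (u + t₀) = Ioi t₀ := by ext; simp
  rwa [e] at h2

lemma sum_tail_le {α : ℝ} (hα : 0 < α) (u : ℝ) (N : ℕ) :
    ∑ n ∈ Finset.range N, tail F (u + α * n) ≤ tail F u + excess F u / α := by
  have h := sum_le_add_integral (φ := fun t => tail F (u + t))
    (fun s t h => tail_antitone F (by linarith)) (fun t => tail_nonneg F _)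
    (integrableOn_tail_add hF0 hint u 0) hα N
  rw [integral_tail_add] at h
  simpa using h

/-- For large `u` this is sum-integral comparison and long-tailedness. On the remaining bounded
range the left side is bounded and the integrated tail is bounded below, so one constant serves all
`u ≥ 0`. -/
lemma exists_sum_tail_le (hFs : IsSubexponential (integratedDist F)) {α : ℝ} (hα : 0 < α)
    (R : ℝ) : ∃ c, 0 ≤ c ∧ ∀ u, 0 ≤ u → ∀ N : ℕ,
      ∑ n ∈ Finset.range N, tail F (u - R + α * n) ≤ c * integratedTail F u := by
  obtain ⟨u₀, hu₀⟩ := eventually_atTop.1 ((eventually_tail_sub_le_integratedTail hF0 hint hFs R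
    one_pos).and (eventually_excess_sub_le hF0 hint hFs R one_lt_two))
  have hpos := integratedTail_pos hF0 hint hFs
  have hex : ∀ u, 0 ≤ excess F u := fun u =>
    setIntegral_nonneg measurableSet_Ioi fun t _ => tail_nonneg F t
  set K := 1 + excess F (-R) / α with hK
  have hK0 : 0 ≤ K := by have := hex (-R); positivity
  refine ⟨max (1 + 2 / α) (K / integratedTail F u₀), le_max_of_le_left (by positivity),
    fun u hu N => (sum_tail_le hF0 hint hα _ N).trans ?_⟩
  rcases le_total u₀ u with h | h
  · obtain ⟨h1, h2⟩ := hu₀ u h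
    refine le_trans ?_ (mul_le_mul_of_nonneg_right (le_max_left _ _) (hpos u).le)
    have : excess F (u - R) / α ≤ 2 * integratedTail F u / α := by gcongr
    calc _ ≤ 1 * integratedTail F u + 2 * integratedTail F u / α := add_le_add h1 this
      _ = _ := by ring
  · refine le_trans ?_ (mul_le_mul_of_nonneg_right (le_max_right _ _) (hpos u).le)
    have h1 : K ≤ K / integratedTail F u₀ * integratedTail F u := by
      rw [div_mul_eq_mul_div, le_div_iff₀ (hpos u₀)]
      exact mul_le_mul_of_nonneg_left (integratedTail_antitone F h) hK0
    refine le_trans ?_ h1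
    have h2 : excess F (u - R) ≤ excess F (-R) := by
      have h3 := excess_sub hF0 hint (u := -R) (v := u - R)
      have h4 := intervalIntegral.integral_nonneg (μ := volume) (f := tail F)
        (show -R ≤ u - R by linarith) fun t _ => tail_nonneg F t
      linarith
    have : excess F (u - R) / α ≤ excess F (-R) / α := by gcongr
    have := tail_le_one F (u - R)
    linarith

end SumTail

/-! ### Comparison of product measures -/

lemma prod_real_swap {X Y : Type*} [MeasurableSpace X] [MeasurableSpace Y] (μ : Measure X)
    (ρ : Measure Y) [IsFiniteMeasure μ] [IsFiniteMeasure ρ] {D : Set (X × Y)}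
    (hD : MeasurableSet D) : (μ.prod ρ).real D = (ρ.prod μ).real {p | (p.2, p.1) ∈ D} :=
  (Measure.measurePreserving_swap (μ := ρ) (ν := μ) |>.measureReal_preimage
    hD.nullMeasurableSet).symm

/-- The hypothesis is integrated over the common second factor. This replaces the law of one of two
independent variables by a multiple of a reference law, even inside a joint event. -/
lemma sum_prod_real_le {ι X Y Z : Type*} [MeasurableSpace X] [MeasurableSpace Y]
    [MeasurableSpace Z] (μ : Measure X) (κ : Measure Z) (ρ : Measure Y) [IsFiniteMeasure μ]
    [IsFiniteMeasure κ] [IsFiniteMeasure ρ] (s : Finset ι) {D : ι → Set (X × Y)}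
    (hD : ∀ i, MeasurableSet (D i)) {D' : Set (Z × Y)} (hD' : MeasurableSet D') {c : ℝ}
    (hc : 0 ≤ c)
    (h : ∀ y, ∑ i ∈ s, μ.real {x | (x, y) ∈ D i} ≤ c * κ.real {z | (z, y) ∈ D'}) :
    ∑ i ∈ s, (μ.prod ρ).real (D i) ≤ c * (κ.prod ρ).real D' := by
  have key : ∑ i ∈ s, (μ.prod ρ) (D i) ≤ ENNReal.ofReal c * (κ.prod ρ) D' := by
    simp_rw [Measure.prod_apply_symm (hD _)]
    rw [Measure.prod_apply_symm hD', ← lintegral_const_mul _ (measurable_measure_prodMk_right hD'),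
      ← lintegral_finsetSum _ fun i _ => measurable_measure_prodMk_right (hD i)]
    refine lintegral_mono fun y => ?_
    have h1 := ENNReal.ofReal_le_ofReal (h y)
    rw [ENNReal.ofReal_sum_of_nonneg fun i _ => measureReal_nonneg, ENNReal.ofReal_mul hc] at h1
    refine (le_of_eq ?_).trans (h1.trans (le_of_eq ?_))
    · exact Finset.sum_congr rfl fun i _ => (ENNReal.ofReal_toReal (measure_ne_top _ _)).symm
    · exact congrArg _ (ENNReal.ofReal_toReal (measure_ne_top _ _))
  have h2 := ENNReal.toReal_mono
    (ENNReal.mul_ne_top ENNReal.ofReal_ne_top (measure_ne_top _ _)) key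
  rwa [ENNReal.toReal_sum fun i _ => measure_ne_top _ _, ENNReal.toReal_mul,
    ENNReal.toReal_ofReal hc] at h2

/-! ### The first crossing of a decreasing line -/

/-- The event that the walk crosses the line `i ↦ R - α * i` for the first time at the step
`n + 1`. -/
def crossing (f : ℝ → ℝ) (R α : ℝ) (n : ℕ) : Set (ℕ → ℝ) :=
  {x | (∀ i ≤ n, walk f i x ≤ R - α * i) ∧ R - α * (n + 1 : ℕ) < walk f (n + 1) x}

/-- The event that the walk crosses the line `i ↦ R - α * i`. -/
def crosses (f : ℝ → ℝ) (R α : ℝ) : Set (ℕ → ℝ) := {x | ∃ i : ℕ, R - α * i < walk f i x}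

section Crossing

variable {f : ℝ → ℝ} {R α : ℝ}

lemma measurableSet_crossing (hf : Measurable f) (n : ℕ) : MeasurableSet (crossing f R α n) := by
  have e : crossing f R α n = (⋂ i, ⋂ (_ : i ≤ n), {x | walk f i x ≤ R - α * i}) ∩
      {x | R - α * (n + 1 : ℕ) < walk f (n + 1) x} := by
    ext x
    simp only [crossing, mem_ofPred_eq, mem_inter_iff, mem_iInter]
  rw [e]
  exact (MeasurableSet.iInter fun i => MeasurableSet.iInter fun _ =>
    measurableSet_le (measurable_walk hf i) measurable_const).inter
    (measurableSet_lt measurable_const (measurable_walk hf _))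

lemma splice_mem_crossing {n : ℕ} (h t : ℕ → ℝ) :
    splice (n + 1) h t ∈ crossing f R α n ↔ h ∈ crossing f R α n := by
  refine and_congr (forall₂_congr fun i hi => ?_) ?_
  · rw [walk_splice f (by omega)]
  · rw [walk_splice f le_rfl]

lemma disjoint_crossing : Pairwise (Function.onFun Disjoint (crossing f R α)) := by
  have key : ∀ k n, k < n → Disjoint (crossing f R α k) (crossing f R α n) := fun k n hkn =>
    disjoint_left.2 fun x hk hn => absurd (hn.1 (k + 1) hkn) (not_le.2 hk.2)
  intro k n hkn
  rcases lt_or_gt_of_ne hkn with h | h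
  · exact key k n h
  · exact (key n k h).symm

lemma crossing_subset (n : ℕ) : crossing f R α n ⊆ crosses f R α := fun _ hx => ⟨n + 1, hx.2⟩

/-- A partial sum above `v ≥ R` lies above the line, so a first crossing occurs no later. The part
of the path after it is a walk on the shifted sequence with at most `N - 1` steps, hence the
condition on `K`. -/
lemma exists_crossing (hR : 0 ≤ R) (hα : 0 ≤ α) {v : ℝ} (hv : R ≤ v) {N K : ℕ} (hK : N ≤ K + 1)
    {x : ℕ → ℝ} (h : v < reflected f 0 N x) : ∃ n < N, x ∈ crossing f R α n ∧
      v < walk f (n + 1) x + reflected f 0 K (shift (n + 1) x) := by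
  classical
  obtain ⟨i, hiN, hi⟩ := exists_lt_walk h
  have hex : ∃ k : ℕ, R - α * k < walk f k x := ⟨i, by
    have : 0 ≤ α * i := by positivity
    linarith⟩
  obtain ⟨k, hk, hmin⟩ : ∃ k : ℕ, R - α * k < walk f k x ∧
      ∀ j < k, walk f j x ≤ R - α * j :=
    ⟨Nat.find hex, Nat.find_spec hex, fun j hj => not_lt.1 (Nat.find_min hex hj)⟩
  have hki : k ≤ i := by
    by_contra! hlt
    have := hmin i hlt
    have : 0 ≤ α * i := by positivity
    linarith
  cases k with
  | zero => simp at hk; linarith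
  | succ n =>
    refine ⟨n, by omega, ⟨fun j hj => hmin j (by omega), hk⟩, ?_⟩
    obtain ⟨r, rfl⟩ : ∃ r, i = n + 1 + r := ⟨i - (n + 1), by omega⟩
    rw [walk_add] at hi
    have := walk_le_reflected f (show r ≤ K by omega) (shift (n + 1) x)
    linarith

/-- Just before the crossing the walk is still below the line, so being high right after it requires
one large step. -/
lemma lt_of_mem_crossing {n : ℕ} {x : ℕ → ℝ} (hx : x ∈ crossing f R α n) {u : ℝ}
    (hu : u < walk f (n + 1) x) : u - R + α * n < f (x n) := by
  rw [walk_succ] at hu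
  have := hx.1 n le_rfl
  linarith

variable {F : Measure ℝ} [IsProbabilityMeasure F] (hf : Measurable f)
include hf

lemma real_inc_gt (hfF : ∀ w, F.real {s | w < f s} ≤ tail F w) (n : ℕ) (w : ℝ) :
    (seqLaw F).real {x | w < f (x n)} ≤ tail F w :=
  ((measurePreserving_eval_infinitePi (fun _ : ℕ => F) n).measureReal_preimage
    (measurableSet_lt measurable_const hf).nullMeasurableSet).trans_le (hfF w)

lemma sum_real_crossing_le (N : ℕ) :
    ∑ n ∈ Finset.range N, (seqLaw F).real (crossing f R α n) ≤ (seqLaw F).real (crosses f R α) := by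
  rw [← measureReal_biUnion_finset (fun i _ j _ hij => disjoint_crossing hij)
    fun n _ => measurableSet_crossing hf n]
  exact measureReal_mono (iUnion₂_subset fun n _ => crossing_subset n)

/-- After a crossing the walk starts afresh. -/
lemma sum_real_crossing_inter_le {u q : ℝ} {K : ℕ}
    (hq : (seqLaw F).real {x | u < reflected f 0 K x} ≤ q) (N : ℕ) :
    ∑ n ∈ Finset.range N, (seqLaw F).real
        (crossing f R α n ∩ {x | u < reflected f 0 K (shift (n + 1) x)}) ≤
      (seqLaw F).real (crosses f R α) * q := by
  have hq0 : 0 ≤ q := measureReal_nonneg.trans hq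
  have hM := measurable_reflected hf 0 K
  have h1 : ∀ n, (seqLaw F).real
      (crossing f R α n ∩ {x | u < reflected f 0 K (shift (n + 1) x)}) ≤
      (seqLaw F).real (crossing f R α n) * q := fun n => by
    have hD : MeasurableSet
        (crossing f R α n ∩ {x | u < reflected f 0 K (shift (n + 1) x)}) :=
      (measurableSet_crossing hf n).inter
        (measurableSet_lt measurable_const (hM.comp (measurable_shift _)))
    rw [real_splice F hD (n + 1)]
    refine le_trans (le_of_eq ?_) (mul_le_mul_of_nonneg_left hq measureReal_nonneg)
    rw [← measureReal_prod_prod]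
    congr 1
    ext ⟨h, t⟩
    simp [splice_mem_crossing]
  refine (Finset.sum_le_sum fun n _ => h1 n).trans ?_
  rw [← Finset.sum_mul]
  exact mul_le_mul_of_nonneg_right (sum_real_crossing_le hf N) hq0

lemma sum_real_crossing_jump_le (hfF : ∀ w, F.real {s | w < f s} ≤ tail F w) {c u : ℝ}
    {N : ℕ} (hc : ∑ n ∈ Finset.range N, tail F (u - R + α * n) ≤ c) :
    ∑ n ∈ Finset.range N, (seqLaw F).real (crossing f R α n ∩ {x | u < walk f (n + 1) x}) ≤ c :=
  (Finset.sum_le_sum fun n _ => (measureReal_mono fun _ hx =>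
    lt_of_mem_crossing hx.1 hx.2).trans (real_inc_gt hf hfF n _)).trans hc

/-- The probability that both the value of the walk at the crossing and its further growth
are large. -/
lemma sum_real_crossing_both_le (H : Measure ℝ) [IsProbabilityMeasure H] {A c ℓ v : ℝ} {K N : ℕ}
    (hA : 0 ≤ A) (hc : 0 ≤ c) (hℓ : 0 ≤ ℓ)
    (h1 : ∀ u, 0 ≤ u → ∑ n ∈ Finset.range N, (seqLaw F).real
      (crossing f R α n ∩ {x | u < walk f (n + 1) x}) ≤ c * tail H u)
    (h2 : ∀ u, 0 ≤ u → (seqLaw F).real {x | u < reflected f 0 K x} ≤ ℓ * tail H u) :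
    ∑ n ∈ Finset.range N, (seqLaw F).real (crossing f R α n ∩ {x | A < walk f (n + 1) x ∧
        A < reflected f 0 K (shift (n + 1) x) ∧
        v < walk f (n + 1) x + reflected f 0 K (shift (n + 1) x)}) ≤
      c * (ℓ * (H.prod H).real {p | A < p.1 ∧ A < p.2 ∧ v < p.1 + p.2}) := by
  have hM := measurable_reflected hf 0 K
  have hS := fun n => measurable_walk hf n
  have hmeas : ∀ {X : Type} [MeasurableSpace X] {g k : X → ℝ} {E : Set X}, Measurable g →
      Measurable k → MeasurableSet E →
      MeasurableSet {p | p ∈ E ∧ A < g p ∧ A < k p ∧ v < g p + k p} := fun hg hk hE =>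
    hE.inter ((measurableSet_lt measurable_const hg).inter
      ((measurableSet_lt measurable_const hk).inter
        (measurableSet_lt measurable_const (hg.add hk))))
  have hcr := fun n => measurableSet_crossing (R := R) (α := α) hf n
  -- For a fixed path up to the crossing, the later growth is independent and its tail is replaced
  -- by `ℓ` times that of `H`. Afterwards, with this second variable fixed, `h1` replaces the value
  -- at the crossing by `c` times `H`.
  have step1 : ∀ n, (seqLaw F).real (crossing f R α n ∩ {x | A < walk f (n + 1) x ∧
        A < reflected f 0 K (shift (n + 1) x) ∧
        v < walk f (n + 1) x + reflected f 0 K (shift (n + 1) x)}) ≤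
      ℓ * ((seqLaw F).prod H).real {p | p.1 ∈ crossing f R α n ∧ A < walk f (n + 1) p.1 ∧
        A < p.2 ∧ v < walk f (n + 1) p.1 + p.2} := fun n => by
    have hD : MeasurableSet (crossing f R α n ∩ {x | A < walk f (n + 1) x ∧
        A < reflected f 0 K (shift (n + 1) x) ∧
        v < walk f (n + 1) x + reflected f 0 K (shift (n + 1) x)}) :=
      hmeas (hS (n + 1)) (hM.comp (measurable_shift _)) (hcr n)
    rw [real_splice F hD (n + 1)]
    have e : {p : (ℕ → ℝ) × (ℕ → ℝ) | splice (n + 1) p.1 p.2 ∈ crossing f R α n ∩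
        {x | A < walk f (n + 1) x ∧ A < reflected f 0 K (shift (n + 1) x) ∧
          v < walk f (n + 1) x + reflected f 0 K (shift (n + 1) x)}} =
        {p | p.1 ∈ crossing f R α n ∧ A < walk f (n + 1) p.1 ∧ A < reflected f 0 K p.2 ∧
          v < walk f (n + 1) p.1 + reflected f 0 K p.2} := by
      ext ⟨h, t⟩
      simp [splice_mem_crossing, walk_splice f (le_refl (n + 1))]
    have m1 : MeasurableSet {p : (ℕ → ℝ) × (ℕ → ℝ) | p.1 ∈ crossing f R α n ∧
        A < walk f (n + 1) p.1 ∧ A < reflected f 0 K p.2 ∧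
        v < walk f (n + 1) p.1 + reflected f 0 K p.2} := hmeas ((hS (n + 1)).comp measurable_fst) (hM.comp measurable_snd)
      (measurable_fst (β := ℕ → ℝ) (hcr n))
    have m2 : MeasurableSet {p : (ℕ → ℝ) × ℝ | p.1 ∈ crossing f R α n ∧
        A < walk f (n + 1) p.1 ∧ A < p.2 ∧ v < walk f (n + 1) p.1 + p.2} := hmeas ((hS (n + 1)).comp measurable_fst) measurable_snd
      (measurable_fst (β := ℝ) (hcr n))
    rw [e, prod_real_swap _ _ m1, prod_real_swap _ _ m2]
    have := sum_prod_real_le (seqLaw F) H (seqLaw F) {()} (fun _ => measurable_swap m1)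
      (measurable_swap m2) hℓ fun h => ?_
    · simpa using! this
    · rw [Finset.sum_singleton]
      by_cases hh : h ∈ crossing f R α n ∧ A < walk f (n + 1) h
      -- Both constraints on the later growth are lower bounds, so they merge into one threshold,
      -- nonnegative because `A` is.
      · have := h2 (max A (v - walk f (n + 1) h)) (le_max_of_le_left hA)
        convert this using 2
        · congr 1
          ext t
          simp [hh.1, hh.2, sub_lt_iff_lt_add']
        · rw [tail]
          congr 1
          ext t
          simp [hh.1, hh.2, sub_lt_iff_lt_add']
      · have e0 : {t | (t, h) ∈ Prod.swap ⁻¹' {p : (ℕ → ℝ) × (ℕ → ℝ) | p.1 ∈ crossing f R α n ∧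
            A < walk f (n + 1) p.1 ∧ A < reflected f 0 K p.2 ∧
            v < walk f (n + 1) p.1 + reflected f 0 K p.2}} = ∅ := by
          ext t
          simp only [mem_preimage, Prod.swap_prod_mk, mem_ofPred_eq, mem_empty_iff_false,
            iff_false]
          tauto
        refine (le_of_eq ?_).trans (mul_nonneg hℓ measureReal_nonneg)
        exact (congrArg _ e0).trans measureReal_empty
  refine (Finset.sum_le_sum fun n _ => step1 n).trans ?_
  rw [← Finset.mul_sum, mul_left_comm]
  refine mul_le_mul_of_nonneg_left ?_ hℓ
  refine sum_prod_real_le (seqLaw F) H H _ (fun n => hmeas ((hS (n + 1)).comp measurable_fst)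
    measurable_snd (measurable_fst (hcr n)))
    (D' := {p : ℝ × ℝ | A < p.1 ∧ A < p.2 ∧ v < p.1 + p.2})
    (by simpa using hmeas (X := ℝ × ℝ) measurable_fst measurable_snd MeasurableSet.univ)
    hc fun y => ?_
  by_cases hy : A < y
  · have := h1 (max A (v - y)) (le_max_of_le_left hA)
    convert this using 2
    · congr 1
      ext t
      simp only [hy, sub_lt_iff_lt_add, mem_ofPred_eq, mem_inter_iff, max_lt_iff, true_and]
      tauto
    · rw [tail]
      congr 1
      ext t
      simp [hy, sub_lt_iff_lt_add]
  · simp [hy]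

end Crossing

/-! ### The tail of a reflected random walk -/

section ReflectedTail

variable {F : Measure ℝ} [IsProbabilityMeasure F] {f : ℝ → ℝ}

lemma exists_real_crosses_le (hf : Measurable f) (hfi : Integrable f F) {α : ℝ}
    (hα : ∫ u, f u ∂F < -α) {δ : ℝ} (hδ : 0 < δ) :
    ∃ R, 0 ≤ R ∧ (seqLaw F).real (crosses f R α) ≤ δ := by
  obtain ⟨C, hC, h⟩ := exists_sum_le_line F hf hfi hα hδ
  refine ⟨C, hC, le_trans (measureReal_mono ?_) h⟩
  rintro x ⟨i, hi⟩
  exact ⟨i, by rw [walk] at hi; linarith⟩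

/-- Decomposition of the event that a reflected walk is large, according to whether the walk is
large when it first crosses a line, or grows large afterwards, or both. -/
lemma real_reflected_le_add {R α A v : ℝ} (hR : 0 ≤ R) (hα : 0 ≤ α) (hv : R ≤ v) {K N : ℕ}
    (hK : N ≤ K + 1) :
    (seqLaw F).real {x | v < reflected f 0 N x} ≤
      ∑ n ∈ Finset.range N, (seqLaw F).real
        (crossing f R α n ∩ {x | v - A < walk f (n + 1) x}) +
      ∑ n ∈ Finset.range N, (seqLaw F).real
        (crossing f R α n ∩ {x | v - A < reflected f 0 K (shift (n + 1) x)}) +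
      ∑ n ∈ Finset.range N, (seqLaw F).real (crossing f R α n ∩ {x | A < walk f (n + 1) x ∧
        A < reflected f 0 K (shift (n + 1) x) ∧
        v < walk f (n + 1) x + reflected f 0 K (shift (n + 1) x)}) := by
  refine le_trans (measureReal_mono (s₂ := ((⋃ n ∈ Finset.range N, crossing f R α n ∩
      {x | v - A < walk f (n + 1) x}) ∪ ⋃ n ∈ Finset.range N, crossing f R α n ∩
      {x | v - A < reflected f 0 K (shift (n + 1) x)}) ∪ ⋃ n ∈ Finset.range N,
      crossing f R α n ∩ {x | A < walk f (n + 1) x ∧ A < reflected f 0 K (shift (n + 1) x) ∧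
        v < walk f (n + 1) x + reflected f 0 K (shift (n + 1) x)}) ?_) ?_
  · intro x hx
    obtain ⟨n, hn, hc, h⟩ := exists_crossing hR hα hv hK hx
    rw [← Finset.mem_range] at hn
    by_cases h1 : v - A < walk f (n + 1) x
    · exact Or.inl (Or.inl (mem_biUnion hn ⟨hc, h1⟩))
    by_cases h2 : v - A < reflected f 0 K (shift (n + 1) x)
    · exact Or.inl (Or.inr (mem_biUnion hn ⟨hc, h2⟩))
    · rw [not_lt] at h1 h2
      exact Or.inr (mem_biUnion hn ⟨hc, by linarith, by linarith, h⟩)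
  · exact (measureReal_union_le _ _).trans (add_le_add ((measureReal_union_le _ _).trans
      (add_le_add (measureReal_biUnion_finset_le _ _) (measureReal_biUnion_finset_le _ _)))
      (measureReal_biUnion_finset_le _ _))

variable (hF0 : F (Iio 0) = 0) (hint : Integrable (fun u : ℝ => u) F)
  (hFs : IsSubexponential (integratedDist F))
include hF0 hint hFs

/-- The tail of a reflected random walk with negative drift is at most of the order of the
integrated tail, uniformly in time. -/
lemma exists_real_reflected_le (hf : Measurable f) (hfi : Integrable f F)
    (hneg : ∫ u, f u ∂F < 0) (hfF : ∀ w, F.real {s | w < f s} ≤ tail F w) :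
    ∃ ℓ, 0 ≤ ℓ ∧ ∀ N v, 0 ≤ v →
      (seqLaw F).real {x | v < reflected f 0 N x} ≤ ℓ * integratedTail F v := by
  have hprob := hFs.isProbabilityMeasure
  have htail := fun u (hu : 0 ≤ u) => tail_integratedDist hF0 hint hu
  have hpos := integratedTail_pos hF0 hint hFs
  set α := -(∫ u, f u ∂F) / 2 with hα
  have hα0 : 0 < α := by linarith
  obtain ⟨R, hR, hp⟩ := exists_real_crosses_le (F := F) hf hfi (α := α) (by linarith)
    (show (0 : ℝ) < 1 / 8 by norm_num)
  obtain ⟨c, hc, hcsum⟩ := exists_sum_tail_le hF0 hint hFs hα0 R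
  obtain ⟨A, hA, hA3⟩ : ∃ A, 0 ≤ A ∧ c * (3 * integratedTail F A) ≤ 1 / 4 := by
    have h := ((tendsto_integratedTail hF0 hint).const_mul 3).const_mul c
    rw [mul_zero, mul_zero] at h
    obtain ⟨A, h1, h2⟩ := ((h.eventually (ge_mem_nhds (show (0 : ℝ) < 1 / 4 by norm_num))).and
      (eventually_ge_atTop 0)).exists
    exact ⟨A, h2, h1⟩
  obtain ⟨v₀, hv₀⟩ := eventually_atTop.1 ((eventually_integratedTail_sub_le hF0 hint hFs A
    one_lt_two).and (hFs.eventually_both_large_le hA))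
  set v₁ := max (max v₀ R) A with hv₁
  -- The same `ℓ` must survive the induction on time. The three terms contribute `2 * c`, `ℓ / 4`
  -- and `ℓ / 4`, which add up to at most `ℓ` as `4 * c ≤ ℓ`; below `v₁` the second entry makes the
  -- bound trivial.
  set ℓ := max (4 * c) (1 / integratedTail F v₁) with hℓ
  have hℓ0 : 0 ≤ ℓ := le_max_of_le_left (by positivity)
  refine ⟨ℓ, hℓ0, fun N => ?_⟩
  induction N with
  | zero =>
    intro v hv
    have e : {x : ℕ → ℝ | v < reflected f 0 0 x} = ∅ := by
      ext x; simpa [reflected] using hv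
    rw [e, measureReal_empty]
    exact mul_nonneg hℓ0 (hpos v).le
  | succ N ih =>
    intro v hv
    rcases le_total v v₁ with h | h
    · refine measureReal_le_one.trans ?_
      calc 1 ≤ 1 / integratedTail F v₁ * integratedTail F v := by
            rw [div_mul_eq_mul_div, one_mul, le_div_iff₀ (hpos v₁), one_mul]
            exact integratedTail_antitone F h
        _ ≤ _ := mul_le_mul_of_nonneg_right (le_max_right _ _) (hpos v).le
    · obtain ⟨h1, h2⟩ := hv₀ v ((le_max_left _ _).trans ((le_max_left _ _).trans h))
      have hvR : R ≤ v := (le_max_right _ _).trans ((le_max_left _ _).trans h)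
      have hvA : 0 ≤ v - A := sub_nonneg.2 ((le_max_right _ _).trans h)
      rw [htail A hA, htail v hv] at h2
      have e1 := sum_real_crossing_jump_le (N := N + 1) hf hfF (hcsum (v - A) hvA (N + 1))
      have e2 := sum_real_crossing_inter_le (R := R) (α := α) hf (ih (v - A) hvA) (N + 1)
      have e3 := sum_real_crossing_both_le (R := R) (α := α) (N := N + 1) (v := v) hf
        (integratedDist F) hA hc hℓ0
        (fun u hu => by
          rw [htail u hu]; exact sum_real_crossing_jump_le hf hfF (hcsum u hu (N + 1)))
        (fun u hu => by rw [htail u hu]; exact ih u hu)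
      refine (real_reflected_le_add (A := A) hR hα0.le hvR le_rfl).trans ?_
      have g := hpos v
      have b1 : c * integratedTail F (v - A) ≤ c * (2 * integratedTail F v) :=
        mul_le_mul_of_nonneg_left h1 hc
      have b2 : (seqLaw F).real (crosses f R α) * (ℓ * integratedTail F (v - A)) ≤
          1 / 8 * (ℓ * (2 * integratedTail F v)) :=
        mul_le_mul hp (mul_le_mul_of_nonneg_left h1 hℓ0)
          (mul_nonneg hℓ0 (hpos _).le) (by norm_num)
      have b3 : c * (ℓ * (3 * integratedTail F A * integratedTail F v)) ≤
          1 / 4 * (ℓ * integratedTail F v) := by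
        calc _ = c * (3 * integratedTail F A) * (ℓ * integratedTail F v) := by ring
          _ ≤ _ := mul_le_mul_of_nonneg_right hA3 (mul_nonneg hℓ0 g.le)
      have b4 : c * (ℓ * ((integratedDist F).prod (integratedDist F)).real
          {p | A < p.1 ∧ A < p.2 ∧ v < p.1 + p.2}) ≤
          c * (ℓ * (3 * integratedTail F A * integratedTail F v)) := by gcongr
      have b5 : 4 * c * integratedTail F v ≤ ℓ * integratedTail F v :=
        mul_le_mul_of_nonneg_right (le_max_left _ _) g.le
      linarith

end ReflectedTail

/-! ### The increments of the dominating walk -/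

section PotInc

variable {F : Measure ℝ} [IsProbabilityMeasure F] (hF0 : F (Iio 0) = 0)
  (hint : Integrable (fun u : ℝ => u) F) (m : ℕ) [NeZero m] (a : ℝ)

omit [NeZero m] in
lemma measurable_potInc (T : ℝ) : Measurable (potInc m a T) := by
  unfold potInc; fun_prop

omit [NeZero m] in
include hint in
lemma integrable_potInc (T : ℝ) : Integrable (potInc m a T) F := by
  have h1 : Integrable (fun s : ℝ => max (s - T) 0) F := (hint.sub (integrable_const T)).pos_part
  have h2 : Integrable (fun s : ℝ => min s T) F := hint.inf (integrable_const T)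
  exact (h1.add (h2.div_const _)).sub (integrable_const a)

include hF0 hint in
-- As `T` grows, the mean of the excess over `T` vanishes by dominated convergence, and the
-- truncated part contributes at most `b / m`, which is less than `a`.
lemma exists_integral_potInc_neg (h : ∫ u, u ∂F < m * a) :
    ∃ T, 0 ≤ T ∧ ∫ s, potInc m a T s ∂F < 0 := by
  have hm0 : (0 : ℝ) < m := by exact_mod_cast NeZero.pos m
  have hae : ∀ᵐ s ∂F, 0 ≤ s := by
    filter_upwards [measure_eq_zero_iff_ae_notMem.1 hF0] with u hu using not_lt.1 hu
  have hlim : Tendsto (fun T : ℝ => ∫ s, max (s - T) 0 ∂F) atTop (𝓝 (∫ _s, (0 : ℝ) ∂F)) := by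
    refine tendsto_integral_filter_of_dominated_convergence (fun s => s) ?_ ?_ hint ?_
    · exact Eventually.of_forall fun T => by fun_prop
    · filter_upwards [eventually_ge_atTop 0] with T hT
      filter_upwards [hae] with s hs
      rw [Real.norm_of_nonneg (le_max_right _ _)]
      exact max_le (by linarith) hs
    · refine Eventually.of_forall fun s => tendsto_const_nhds.congr' ?_
      filter_upwards [eventually_ge_atTop s] with T hT
      exact (max_eq_right (by linarith)).symm
  rw [integral_zero] at hlim
  have hgap : 0 < a - (∫ u, u ∂F) / m := by
    rw [sub_pos, div_lt_iff₀ hm0]; linarith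
  obtain ⟨T, hT, hT0⟩ := ((hlim.eventually (gt_mem_nhds hgap)).and (eventually_ge_atTop 0)).exists
  refine ⟨T, hT0, ?_⟩
  have h1 : Integrable (fun s : ℝ => max (s - T) 0) F := (hint.sub (integrable_const T)).pos_part
  have h2 : Integrable (fun s : ℝ => min s T) F := hint.inf (integrable_const T)
  have h3 : ∫ s, min s T ∂F ≤ ∫ s, s ∂F := integral_mono h2 hint fun s => min_le_left _ _
  have h4 : ∫ s, potInc m a T s ∂F =
      ∫ s, max (s - T) 0 ∂F + (∫ s, min s T ∂F) / m - a := by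
    have h6 : Integrable (fun s : ℝ => min s T / m) F := h2.div_const _
    have h7 : Integrable (fun s : ℝ => max (s - T) 0 + min s T / m) F := h1.add h6
    unfold potInc
    rw [integral_sub h7 (integrable_const a), integral_add h1 h6, integral_div]
    simp
  have h5 : (∫ s, min s T ∂F) / m ≤ (∫ s, s ∂F) / m := by gcongr
  rw [h4]
  linarith

variable {a}

/-- This turns a large increment of the dominating walk into a large service time. -/
lemma potInc_le (ha : 0 ≤ a) {T s : ℝ} (hT : 0 ≤ T) (hs : 0 ≤ s) : potInc m a T s ≤ s := by
  have hm := one_le_cast (m := m)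
  have h1 : min s T / m ≤ min s T := div_le_self (le_min hs hT) hm
  unfold potInc
  rcases le_total s T with h | h
  · rw [max_eq_right (by linarith)]
    linarith [min_le_left s T]
  · rw [max_eq_left (by linarith)]
    linarith [min_le_right s T]

include hF0 in
lemma real_potInc_gt_le (ha : 0 ≤ a) {T : ℝ} (hT : 0 ≤ T) (w : ℝ) :
    F.real {s | w < potInc m a T s} ≤ tail F w := by
  refine ENNReal.toReal_mono (measure_ne_top _ _) (measure_mono_ae ?_)
  filter_upwards [measure_eq_zero_iff_ae_notMem.1 hF0] with s hs hw
  exact lt_of_lt_of_le hw (potInc_le m ha hT (not_lt.1 hs))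

end PotInc

lemma ae_seqLaw_nonneg {F : Measure ℝ} [IsProbabilityMeasure F] (hF0 : F (Iio 0) = 0) :
    ∀ᵐ x ∂(seqLaw F), ∀ j, 0 ≤ x j := by
  rw [ae_all_iff]
  intro j
  have h := (measurePreserving_eval_infinitePi (fun _ : ℕ => F) j).quasiMeasurePreserving.ae
    (measure_eq_zero_iff_ae_notMem.1 hF0)
  filter_upwards [h] with x hx using not_lt.1 hx

/-! ### Upper bound for the tail of the maximal dater -/

section Upper

variable {F : Measure ℝ} [IsProbabilityMeasure F] (hF0 : F (Iio 0) = 0)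
  (hint : Integrable (fun u : ℝ => u) F) (m : ℕ) [NeZero m] {a b : ℝ}

/-- The event that one of the first `n` partial sums of `f (x j)` exceeds a given line. -/
def aboveLine (f : ℝ → ℝ) (C c : ℝ) (n : ℕ) : Set (ℕ → ℝ) :=
  {x | ∃ i ≤ n, C + c * i < walk f i x}

lemma measurableSet_aboveLine {f : ℝ → ℝ} (hf : Measurable f) (C c : ℝ) (n : ℕ) :
    MeasurableSet (aboveLine f C c n) := by
  have e : aboveLine f C c n = ⋃ i, ⋃ (_ : i ≤ n), {x | C + c * i < walk f i x} := by
    ext x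
    simp only [aboveLine, mem_ofPred_eq, mem_iUnion, exists_prop]
  rw [e]
  exact MeasurableSet.iUnion fun i => MeasurableSet.iUnion fun _ =>
    measurableSet_lt measurable_const (measurable_walk hf i)

lemma splice_mem_aboveLine {f : ℝ → ℝ} {C c : ℝ} {n : ℕ} (h t : ℕ → ℝ) :
    splice n h t ∈ aboveLine f C c n ↔ h ∈ aboveLine f C c n :=
  exists_congr fun i => and_congr_right fun hi => by rw [walk_splice f hi]

lemma exists_real_aboveLine_le {f : ℝ → ℝ} (hf : Measurable f) (hfi : Integrable f F) {c : ℝ}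
    (hc : ∫ u, f u ∂F < c) {δ : ℝ} (hδ : 0 < δ) :
    ∃ C₀, 0 ≤ C₀ ∧ ∀ C, C₀ ≤ C → ∀ n, (seqLaw F).real (aboveLine f C c n) ≤ δ := by
  obtain ⟨C₀, hC, h⟩ := exists_sum_le_line F hf hfi hc hδ
  refine ⟨C₀, hC, fun C hCC n => le_trans (measureReal_mono ?_) h⟩
  rintro x ⟨i, -, hi⟩
  exact ⟨i, by rw [walk] at hi; linarith⟩

include hF0 hint

/-- Up to a small fraction of the integrated tail, the maximal dater is large only if one service
time exceeds its fluid level. -/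
lemma exists_real_pastDater_le (hFs : IsSubexponential (integratedDist F)) (ha : 0 < a)
    (hb : ∫ u, u ∂F = b) (hb0 : 0 ≤ b) (hab : b < m * a) {ε δ : ℝ} (hε0 : 0 < ε) (hε1 : ε ≤ 1)
    (hδ : 0 < δ) :
    ∃ C, 0 ≤ C ∧ ∀ᶠ v in atTop, ∀ N, (seqLaw F).real {x | v < pastDater m a N x} ≤
      ∑ n ∈ Finset.range (N + 1),
        tail F (fluidLevel m a (m * a - b) (v - C) ((1 - ε) * n)) + δ * integratedTail F v := by
  have hprob := hFs.isProbabilityMeasure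
  have htail := fun u (hu : 0 ≤ u) => tail_integratedDist hF0 hint hu
  have hpos := integratedTail_pos hF0 hint hFs
  obtain ⟨T, hT, hTneg⟩ := exists_integral_potInc_neg hF0 hint m a (by rwa [hb])
  set f := potInc m a T with hfdef
  have hf : Measurable f := measurable_potInc m a T
  have hfi : Integrable f F := integrable_potInc hint m a T
  have hfF := real_potInc_gt_le hF0 m ha.le hT
  set α := -(∫ u, f u ∂F) / 2 with hα
  have hα0 : 0 < α := by linarith
  obtain ⟨ℓ, hℓ0, hℓ⟩ := exists_real_reflected_le hF0 hint hFs hf hfi hTneg hfF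
  -- The denominator collects the errors: `2 * ℓ` each from regrowth after the crossing and from two
  -- large parts, and `3 * (1 + 2 / α)` from a jump followed by one of three irregularities.
  set δ' := δ / (4 * ℓ + 3 * (1 + 2 / α) + 1) with hδ'
  have hden : 0 < 4 * ℓ + 3 * (1 + 2 / α) + 1 := by positivity
  have hδ'0 : 0 < δ' := by positivity
  obtain ⟨R, hR, hp⟩ := exists_real_crosses_le (F := F) hf hfi (α := α) (by linarith) hδ'0
  obtain ⟨c, hc, hcsum⟩ := exists_sum_tail_le hF0 hint hFs hα0 R
  obtain ⟨A, hA, hA3⟩ : ∃ A, 0 ≤ A ∧ c * (3 * integratedTail F A) ≤ δ' := by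
    have h := ((tendsto_integratedTail hF0 hint).const_mul 3).const_mul c
    rw [mul_zero, mul_zero] at h
    obtain ⟨A, h1, h2⟩ := ((h.eventually (ge_mem_nhds hδ'0)).and (eventually_ge_atTop 0)).exists
    exact ⟨A, h2, h1⟩
  set θ := α * ε / 8 with hθ
  have hθ0 : 0 < θ := by positivity
  obtain ⟨C₁, hC₁, hB₁⟩ := exists_real_aboveLine_le (F := F) (f := id) measurable_id hint
    (c := b + θ) (by simp only [id]; linarith) hδ'0
  obtain ⟨C₂, hC₂, hB₂⟩ := exists_real_aboveLine_le (F := F) (f := fun u => -u) measurable_neg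
    hint.neg (c := -b + θ) (by rw [integral_neg]; linarith) hδ'0
  obtain ⟨C₃, hC₃, hB₃⟩ := exists_real_aboveLine_le (F := F) hf hfi (c := -α) (by linarith) hδ'0
  set C := max C₁ (max C₂ C₃) with hC
  set bad : ℕ → Set (ℕ → ℝ) := fun n => aboveLine id C (b + θ) n ∪
    (aboveLine (fun u => -u) C (-b + θ) n ∪ aboveLine f C (-α) n) with hbad
  have hbadm : ∀ n, MeasurableSet (bad n) := fun n =>
    (measurableSet_aboveLine measurable_id _ _ _).union
      ((measurableSet_aboveLine measurable_neg _ _ _).union (measurableSet_aboveLine hf _ _ _))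
  have hbad3 : ∀ n, (seqLaw F).real (bad n) ≤ 3 * δ' := fun n => by
    have h1 := hB₁ C (le_max_left _ _) n
    have h2 := hB₂ C ((le_max_left _ _).trans (le_max_right _ _)) n
    have h3 := hB₃ C ((le_max_right _ _).trans (le_max_right _ _)) n
    refine (measureReal_union_le _ _).trans ?_
    have := measureReal_union_le (μ := seqLaw F) (aboveLine (fun u => -u) C (-b + θ) n)
      (aboveLine f C (-α) n)
    linarith
  obtain ⟨C', hC'0, hC'⟩ := exists_pastDater_le (m := m) (b := b) ha hb0 (by linarith) hT hα0 hε0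
    hε1 hA (C := C) (le_max_of_le_left hC₁)
  refine ⟨C', hC'0, ?_⟩
  -- The gap allowed between the dater and the reflected walk that dominates it.
  set s := m * T + a with hs
  have hv' : Tendsto (fun v : ℝ => v - s) atTop atTop := by
    simpa [sub_eq_add_neg] using tendsto_atTop_add_const_right atTop (-s) tendsto_id
  filter_upwards [eventually_ge_atTop C', hv'.eventually_ge_atTop R, hv'.eventually_ge_atTop A,
    hv'.eventually_ge_atTop 0, hv'.eventually (hFs.eventually_both_large_le hA),
    eventually_integratedTail_sub_le hF0 hint hFs s one_lt_two,
    eventually_integratedTail_sub_le hF0 hint hFs (s + A) one_lt_two,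
    eventually_tail_sub_le_integratedTail hF0 hint hFs (s + A + R) one_pos,
    eventually_excess_sub_le hF0 hint hFs (s + A + R) one_lt_two]
    with v hvC hvR hvA hv0 hboth hG1 hG2 hG3 hG4
  intro N
  set v' := v - s with hv'def
  rw [htail A hA, htail v' hv0] at hboth
  set w : ℕ → ℝ := fun n => v - (s + A + R) + α * n with hw
  -- Let `n` be the first crossing step of the dominating walk. If the walk after it neither exceeds
  -- `v' - A` nor makes both parts larger than `A`, it stays below `A`, so the queue was nearly
  -- empty when customer `n` arrived, and `x n` exceeds `w n`. Then either the service times after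
  -- that arrival are irregular or `x n` exceeds the fluid level.
  have hsub : (seqLaw F).real {x | v < pastDater m a N x} ≤ (seqLaw F).real
      (((⋃ n ∈ Finset.range (N + 1),
          {x : ℕ → ℝ | fluidLevel m a (m * a - b) (v - C') ((1 - ε) * n) < x n}) ∪
        ⋃ n ∈ Finset.range (N + 1), bad n ∩ {x | w n < x n}) ∪
      ((⋃ n ∈ Finset.range (N + 1),
          crossing f R α n ∩ {x | v' - A < reflected f 0 N (shift (n + 1) x)}) ∪
        ⋃ n ∈ Finset.range (N + 1), crossing f R α n ∩ {x | A < walk f (n + 1) x ∧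
          A < reflected f 0 N (shift (n + 1) x) ∧
          v' < walk f (n + 1) x + reflected f 0 N (shift (n + 1) x)})) := by
    refine ENNReal.toReal_mono (measure_ne_top _ _) (measure_mono_ae ?_)
    filter_upwards [ae_seqLaw_nonneg hF0] with x hx hZ
    have hZ' : v < pastDater m a N x := hZ
    have hM := pastDater_le_reflected (m := m) (a := a) hT hx N
    obtain ⟨n, hn, hcr, hlt⟩ := exists_crossing (f := f) hR hα0.le hvR le_rfl
      (x := x) (N := N + 1) (by rw [hv'def, hs]; linarith)
    have hnr := Finset.mem_range.2 hn
    by_cases h2 : v' - A < reflected f 0 N (shift (n + 1) x)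
    · exact Or.inr (Or.inl (mem_biUnion hnr ⟨hcr, h2⟩))
    by_cases h3 : A < reflected f 0 N (shift (n + 1) x)
    · exact Or.inr (Or.inr (mem_biUnion hnr ⟨hcr, by linarith, h3, hlt⟩))
    rw [not_lt] at h2 h3
    have hjump : w n < x n := by
      have h4 := lt_of_mem_crossing hcr (u := v' - A) (by linarith)
      have h5 := potInc_le m ha.le hT (hx n)
      simp only [hw]
      linarith
    by_cases h4 : x ∈ bad n
    · exact Or.inl (Or.inr (mem_biUnion hnr ⟨h4, hjump⟩))
    refine Or.inl (Or.inl (mem_biUnion hnr ?_))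
    by_contra h5
    simp only [hbad, aboveLine, mem_union, mem_ofPred_eq, not_or, not_exists, not_and,
      not_lt] at h4
    refine absurd hZ' (not_lt.2 (hC' v hvC N n (by omega) x hx (fun i hi => ?_) (fun i hi => ?_)
      (fun i hi => ?_) ?_ (not_lt.1 h5)))
    · rw [← hθ]
      linarith [h4.1 i hi]
    · have h6 := h4.2.1 i hi
      have e : walk (fun u => -u) i x = -walk id i x := by simp [walk]
      rw [e] at h6
      rw [← hθ]
      linarith
    · linarith [h4.2.2 i hi]
    · refine le_trans ?_ h3
      refine reflected_le (by simpa using walk_le_reflected f (by omega) _) fun i hi =>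
        walk_le_reflected f (by omega) _
  refine hsub.trans ?_
  have b1 : (seqLaw F).real (⋃ n ∈ Finset.range (N + 1),
      {x : ℕ → ℝ | fluidLevel m a (m * a - b) (v - C') ((1 - ε) * n) < x n}) ≤
      ∑ n ∈ Finset.range (N + 1),
        tail F (fluidLevel m a (m * a - b) (v - C') ((1 - ε) * n)) := by
    refine (measureReal_biUnion_finset_le _ _).trans (le_of_eq ?_)
    exact Finset.sum_congr rfl fun n _ => real_coord_gt F n _
  have b2 : (seqLaw F).real (⋃ n ∈ Finset.range (N + 1), bad n ∩ {x | w n < x n}) ≤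
      3 * δ' * ((1 + 2 / α) * integratedTail F v) := by
    refine (measureReal_biUnion_finset_le _ _).trans ?_
    have h1 : ∀ n, (seqLaw F).real (bad n ∩ {x | w n < x n}) ≤ 3 * δ' * tail F (w n) := fun n => by
      -- Irregularity concerns only the customers after the big one, with indices below `n`, so it
      -- is independent of the jump `x n`.
      rw [real_head_inter_coord F (hbadm n) n fun h t => ?_]
      · exact mul_le_mul_of_nonneg_right (hbad3 n) (tail_nonneg F _)
      · simp only [hbad, mem_union, splice_mem_aboveLine]
    refine (Finset.sum_le_sum fun n _ => h1 n).trans ?_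
    rw [← Finset.mul_sum]
    refine mul_le_mul_of_nonneg_left ((sum_tail_le hF0 hint hα0 _ _).trans ?_) (by positivity)
    have : excess F (v - (s + A + R)) / α ≤ 2 * integratedTail F v / α := by gcongr
    calc _ ≤ 1 * integratedTail F v + 2 * integratedTail F v / α := add_le_add hG3 this
      _ = _ := by ring
  have b3 := sum_real_crossing_inter_le (R := R) (α := α) hf
    (hℓ N (v' - A) (sub_nonneg.2 hvA)) (N + 1)
  have b3' : (seqLaw F).real (crosses f R α) * (ℓ * integratedTail F (v' - A)) ≤
      δ' * (ℓ * (2 * integratedTail F v)) := by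
    have e : v' - A = v - (s + A) := by rw [hv'def]; ring
    rw [e]
    exact mul_le_mul hp (mul_le_mul_of_nonneg_left hG2 hℓ0)
      (mul_nonneg hℓ0 (hpos _).le) hδ'0.le
  have b4 := sum_real_crossing_both_le (R := R) (α := α) (N := N + 1) (v := v') hf
    (integratedDist F) hA hc hℓ0
    (fun u hu => by
      rw [htail u hu]; exact sum_real_crossing_jump_le hf hfF (hcsum u hu (N + 1)))
    (fun u hu => by rw [htail u hu]; exact hℓ N u hu)
  have b4' : c * (ℓ * ((integratedDist F).prod (integratedDist F)).real
      {p | A < p.1 ∧ A < p.2 ∧ v' < p.1 + p.2}) ≤ δ' * (ℓ * (2 * integratedTail F v)) := by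
    calc _ ≤ c * (ℓ * (3 * integratedTail F A * integratedTail F v')) := by gcongr
      _ = c * (3 * integratedTail F A) * (ℓ * integratedTail F v') := by ring
      _ ≤ _ := mul_le_mul hA3 (mul_le_mul_of_nonneg_left hG1 hℓ0)
        (mul_nonneg hℓ0 (hpos _).le) hδ'0.le
  have hfin : δ' * (4 * ℓ + 3 * (1 + 2 / α)) * integratedTail F v ≤ δ * integratedTail F v := by
    refine mul_le_mul_of_nonneg_right ?_ (hpos v).le
    rw [hδ', div_mul_eq_mul_div, div_le_iff₀ hden]
    nlinarith
  have u1 := measureReal_union_le (μ := seqLaw F) (⋃ n ∈ Finset.range (N + 1),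
      {x : ℕ → ℝ | fluidLevel m a (m * a - b) (v - C') ((1 - ε) * n) < x n})
    (⋃ n ∈ Finset.range (N + 1), bad n ∩ {x | w n < x n})
  have u2 := measureReal_union_le (μ := seqLaw F) (⋃ n ∈ Finset.range (N + 1),
      crossing f R α n ∩ {x | v' - A < reflected f 0 N (shift (n + 1) x)})
    (⋃ n ∈ Finset.range (N + 1), crossing f R α n ∩ {x | A < walk f (n + 1) x ∧
      A < reflected f 0 N (shift (n + 1) x) ∧
      v' < walk f (n + 1) x + reflected f 0 N (shift (n + 1) x)})
  refine (measureReal_union_le _ _).trans ((add_le_add u1 u2).trans ?_)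
  have u3 := (measureReal_biUnion_finset_le (μ := seqLaw F) (Finset.range (N + 1)) fun n =>
    crossing f R α n ∩ {x | v' - A < reflected f 0 N (shift (n + 1) x)}).trans (b3.trans b3')
  have u4 := (measureReal_biUnion_finset_le (μ := seqLaw F) (Finset.range (N + 1)) fun n =>
    crossing f R α n ∩ {x | A < walk f (n + 1) x ∧ A < reflected f 0 N (shift (n + 1) x) ∧
      v' < walk f (n + 1) x + reflected f 0 N (shift (n + 1) x)}).trans (b4.trans b4')
  linarith

end Upper

/-! ### Measurability of the maximal dater -/

section Measurability

lemma rearrange_add_const {m : ℕ} (v : Fin m → ℝ) (c : ℝ) :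
    rearrange (fun i => v i + c) = fun i => rearrange v i + c := by
  refine (Tuple.comp_sort_eq_comp_iff_monotone.2 ?_).symm
  exact fun i j h => by simpa using Tuple.monotone_sort v h

/-- A monotone map that commutes with adding constants is 1-Lipschitz for the supremum distance. -/
lemma continuous_rearrange {m : ℕ} : Continuous (rearrange : (Fin m → ℝ) → Fin m → ℝ) := by
  refine LipschitzWith.continuous (K := 1) (LipschitzWith.of_dist_le_mul fun v w => ?_)
  rw [NNReal.coe_one, one_mul, dist_pi_le_iff dist_nonneg]
  have key : ∀ (v w : Fin m → ℝ) (i : Fin m), rearrange v i ≤ rearrange w i + dist v w := by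
    intro v w i
    have h : v ≤ fun i => w i + dist v w := fun j => by
      have h1 := dist_le_pi_dist v w j
      have h2 := le_abs_self (v j - w j)
      rw [Real.dist_eq] at h1
      linarith
    have h3 := rearrange_mono h i
    rwa [rearrange_add_const] at h3
  intro i
  rw [Real.dist_eq, abs_sub_le_iff]
  constructor
  · linarith [key v w i]
  · have := key w v i
    rw [dist_comm] at this
    linarith

lemma measurable_state {m : ℕ} [NeZero m] (a : ℝ) (w : Fin m → ℝ) (N : ℕ) :
    Measurable (state a w N) := by
  induction N with
  | zero => exact measurable_const
  | succ N ih =>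
    refine continuous_rearrange.measurable.comp (measurable_pi_lambda _ fun i => ?_)
    have h1 : Measurable fun x => state a w N (shift 1 x) i :=
      (measurable_pi_apply i).comp (ih.comp (measurable_shift 1))
    have h2 : Measurable fun x : ℕ → ℝ => (Pi.single 0 (x 0) : Fin m → ℝ) i := by
      rcases eq_or_ne i 0 with rfl | hi
      · simpa using measurable_pi_apply 0
      · simp [hi]
    exact ((h1.add h2).sub measurable_const).max measurable_const

lemma measurable_pastDater (m : ℕ) [NeZero m] (a : ℝ) (N : ℕ) : Measurable (pastDater m a N) := by
  have h : ∀ i, Measurable fun x => state (m := m) a 0 N (shift 1 x) i := fun i =>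
    (measurable_pi_apply i).comp ((measurable_state a 0 N).comp (measurable_shift 1))
  exact ((h 0).add (measurable_pi_apply 0)).max (h _)

lemma pastDater_mono (m : ℕ) [NeZero m] (a : ℝ) (x : ℕ → ℝ) :
    Monotone fun N => pastDater m a N x := by
  -- Only indices `-N, …, 0` enter the dater, so the values that `toNat` assigns at positive indices
  -- are irrelevant.
  have h : ∀ N, backwardDater m a (fun k : ℤ => x (-k).toNat) N = pastDater m a N x := fun N =>
    dater_eq_pastDater fun k hk => by
      change x (-((k : ℤ) - N)).toNat = x (N - k)
      congr 1
      omega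
  intro N M hNM
  change pastDater m a N x ≤ pastDater m a M x
  rw [← h, ← h]
  exact backwardDater_mono m a _ hNM

end Measurability

/-! ### The fluid integral -/

section Fluid

variable (F : Measure ℝ) (m : ℕ) (a d : ℝ)

/-- The integral of the tail at the fluid level. -/
def fluidIntegral (u : ℝ) : ℝ := ∫ t in Ioi 0, tail F (fluidLevel m a d u t)

variable {F a d} [IsProbabilityMeasure F]

lemma antitone_tail_fluidLevel (ha : 0 ≤ a) (hd : 0 ≤ d) (u : ℝ) :
    Antitone fun t => tail F (fluidLevel m a d u t) := fun s t h =>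
  tail_antitone F (min_le_min (by gcongr) (by gcongr))

variable [NeZero m]

lemma fluidLevel_zero {u : ℝ} (hu : 0 ≤ u) : fluidLevel m a d u 0 = u := by
  simp only [fluidLevel, zero_mul, add_zero]
  exact min_eq_left (le_mul_of_one_le_left hu one_le_cast)

variable (hF0 : F (Iio 0) = 0) (hint : Integrable (fun u : ℝ => u) F)
include hF0 hint

omit [NeZero m] in
lemma integrableOn_tail_add_mul (u t₀ : ℝ) {κ : ℝ} (hκ : 0 < κ) :
    IntegrableOn (fun t => tail F (u + t * κ)) (Ioi t₀) := by
  have h := (integrableOn_Ioi_comp_mul_left_iff (fun t => tail F (u + t)) t₀ hκ).2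
    (integrableOn_tail_add hF0 hint u _)
  simpa only [mul_comm] using h

omit [NeZero m] hF0 hint [IsProbabilityMeasure F] in
lemma integral_tail_add_mul (u t₀ : ℝ) {κ : ℝ} (hκ : 0 < κ) :
    ∫ t in Ioi t₀, tail F (u + t * κ) = excess F (u + t₀ * κ) / κ := by
  have h := integral_comp_mul_left_Ioi (fun t => tail F (u + t)) t₀ hκ
  rw [integral_tail_add, smul_eq_mul, inv_mul_eq_div] at h
  simpa only [mul_comm] using h

lemma integrableOn_tail_fluidLevel (ha : 0 < a) (hd : 0 < d) {u : ℝ} (hu : 0 ≤ u) :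
    IntegrableOn (fun t => tail F (fluidLevel m a d u t)) (Ioi 0) := by
  refine Integrable.mono' (integrableOn_tail_add_mul hF0 hint u 0 (lt_min ha hd))
    (antitone_tail_fluidLevel m ha.le hd.le u).measurable.aestronglyMeasurable ?_
  refine (ae_restrict_iff' measurableSet_Ioi).2 (Eventually.of_forall fun t ht => ?_)
  have ht0 : 0 ≤ t := le_of_lt ht
  rw [Real.norm_of_nonneg (tail_nonneg F _)]
  refine tail_antitone F (le_min ?_ ?_)
  · gcongr; exact min_le_left _ _
  · have : u ≤ m * u := le_mul_of_one_le_left hu one_le_cast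
    gcongr; exact min_le_right _ _

/-- The fluid integral in terms of the mean excess. -/
lemma fluidIntegral_eq (ha : 0 < a) (hd : 0 < d) {u : ℝ} (hu : 0 ≤ u) :
    fluidIntegral F m a d u = 1 / a * excess F u +
      max (1 / d - 1 / a) 0 * excess F ((m * a - d) * u / (a - d)) := by
  have hm := one_le_cast (m := m)
  rcases le_or_gt a d with h | h
  · have h1 : 1 / d ≤ 1 / a := one_div_le_one_div_of_le ha h
    rw [max_eq_right (by linarith), zero_mul, add_zero]
    have h2 : fluidIntegral F m a d u = ∫ t in Ioi 0, tail F (u + t * a) := by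
      refine setIntegral_congr_fun measurableSet_Ioi fun t ht => ?_
      have ht0 : 0 < t := ht
      change tail F (min _ _) = _
      rw [min_eq_left]
      have : u ≤ m * u := le_mul_of_one_le_left hu hm
      gcongr
    rw [h2, integral_tail_add_mul _ _ ha, zero_mul, add_zero]
    ring
  · have hda : 0 < a - d := by linarith
    have h1 : 1 / a ≤ 1 / d := one_div_le_one_div_of_le hd h.le
    rw [max_eq_left (by linarith)]
    -- The time at which `u + t * a` and `m * u + t * d` meet; the first line is the lower one
    -- before it, the second after it.
    set τ := (m - 1) * u / (a - d) with hτ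
    have hτ0 : 0 ≤ τ := div_nonneg (mul_nonneg (by linarith) hu) hda.le
    have hτe : τ * (a - d) = (m - 1) * u := div_mul_cancel₀ _ hda.ne'
    have e1 : u + τ * a = (m * a - d) * u / (a - d) := by
      rw [hτ]; field_simp; ring
    have e2 : m * u + τ * d = (m * a - d) * u / (a - d) := by
      rw [← e1]; linarith
    have hi := integrableOn_tail_fluidLevel m hF0 hint ha hd hu
    have s1 : fluidIntegral F m a d u = (∫ t in Ioc 0 τ, tail F (fluidLevel m a d u t)) +
        ∫ t in Ioi τ, tail F (fluidLevel m a d u t) := by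
      rw [fluidIntegral, ← Ioc_union_Ioi_eq_Ioi hτ0]
      exact setIntegral_union Ioc_disjoint_Ioi_same measurableSet_Ioi
        (hi.mono_set Ioc_subset_Ioi_self) (hi.mono_set (Ioi_subset_Ioi hτ0))
    have s2 : ∫ t in Ioc 0 τ, tail F (fluidLevel m a d u t) =
        ∫ t in Ioc 0 τ, tail F (u + t * a) := by
      refine setIntegral_congr_fun measurableSet_Ioc fun t ht => ?_
      change tail F (min _ _) = _
      rw [min_eq_left]
      have : t * (a - d) ≤ τ * (a - d) := mul_le_mul_of_nonneg_right ht.2 hda.le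
      linarith
    have s3 : ∫ t in Ioi τ, tail F (fluidLevel m a d u t) =
        ∫ t in Ioi τ, tail F (m * u + t * d) := by
      refine setIntegral_congr_fun measurableSet_Ioi fun t ht => ?_
      change tail F (min _ _) = _
      rw [min_eq_right]
      have : τ * (a - d) ≤ t * (a - d) := mul_le_mul_of_nonneg_right (le_of_lt ht) hda.le
      linarith
    have hia := integrableOn_tail_add_mul hF0 hint u 0 ha
    have s4 : (∫ t in Ioc 0 τ, tail F (u + t * a)) + ∫ t in Ioi τ, tail F (u + t * a) =
        ∫ t in Ioi 0, tail F (u + t * a) := by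
      rw [← Ioc_union_Ioi_eq_Ioi hτ0]
      exact (setIntegral_union Ioc_disjoint_Ioi_same measurableSet_Ioi
        (hia.mono_set Ioc_subset_Ioi_self) (hia.mono_set (Ioi_subset_Ioi hτ0))).symm
    rw [integral_tail_add_mul _ _ ha, integral_tail_add_mul _ _ ha, e1, zero_mul, add_zero] at s4
    rw [s1, s2, s3, integral_tail_add_mul _ _ hd, e2]
    linear_combination s4

end Fluid

/-! ### Lower bound for the tail of the maximal dater -/

section Lower

variable {F : Measure ℝ} [IsProbabilityMeasure F] (hF0 : F (Iio 0) = 0)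
  (hint : Integrable (fun u : ℝ => u) F) (m : ℕ) [NeZero m] {a b : ℝ}

include hF0 hint

/-- The maximal dater is large if one service time exceeds its fluid level. -/
lemma exists_le_real_pastDater (ha : 0 < a) (hb : ∫ u, u ∂F = b) (hab : b < m * a) {ε δ : ℝ}
    (hε0 : 0 < ε) (hδ : 0 < δ) :
    ∃ C, 0 ≤ C ∧ ∀ᶠ v in atTop, ∀ N, (1 - δ) * ∑ n ∈ Finset.range (N + 1),
        tail F (fluidLevel m a (m * a - b) (v + C) ((1 + ε) * n)) ≤
      (seqLaw F).real {x | v < pastDater m a N x} := by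
  set d := m * a - b with hd
  have hd0 : 0 < d := by linarith
  obtain ⟨C, hC, hB⟩ := exists_real_aboveLine_le (F := F) (f := fun u => -u) measurable_neg
    hint.neg (c := -b + ε * d) (by rw [integral_neg, hb]; linarith [mul_pos hε0 hd0])
    (half_pos hδ)
  refine ⟨C, hC, ?_⟩
  -- This quantity bounds the expected number of service times above their fluid levels, so for
  -- large `v` such an exceedance is itself unlikely, uniformly in the number of terms.
  have hlim : Tendsto (fun v : ℝ => tail F v + (excess F v / min a d) / (1 + ε)) atTop (𝓝 0) := by
    simpa using (tendsto_tail F).add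
      (((tendsto_excess hF0 hint).div_const (min a d)).div_const (1 + ε))
  have hvC : Tendsto (fun v : ℝ => v + C) atTop atTop :=
    tendsto_atTop_add_const_right atTop C tendsto_id
  filter_upwards [hvC.eventually (hlim.eventually (ge_mem_nhds (half_pos hδ))),
    eventually_ge_atTop 0] with v hv hv0
  intro N
  set u := v + C with hu
  have hu0 : 0 ≤ u := by linarith
  set g : ℕ → ℝ := fun n => fluidLevel m a d u ((1 + ε) * n) with hg
  set bad := fun n => aboveLine (fun u : ℝ => -u) C (-b + ε * d) n with hbad
  set early : ℕ → Set (ℕ → ℝ) := fun n => ⋃ j ∈ Finset.range n, {x | g j < x j} with hearly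
  have hmA : ∀ j, MeasurableSet {x : ℕ → ℝ | g j < x j} := fun j =>
    measurableSet_lt measurable_const (measurable_pi_apply j)
  have hmE : ∀ n, MeasurableSet (early n) := fun n =>
    Finset.measurableSet_biUnion _ fun j _ => hmA j
  have hmB : ∀ n, MeasurableSet (bad n) := fun n => measurableSet_aboveLine measurable_neg _ _ _
  have hsum : ∀ n, ∑ j ∈ Finset.range n, tail F (g j) ≤ δ / 2 := fun n => by
    have h1 := sum_le_add_integral (antitone_tail_fluidLevel (F := F) m ha.le hd0.le u)
      (fun t => tail_nonneg F _) (integrableOn_tail_fluidLevel m hF0 hint ha hd0 hu0)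
      (show 0 < 1 + ε by linarith) n
    rw [fluidLevel_zero m hu0] at h1
    refine h1.trans (le_trans ?_ hv)
    gcongr
    have h2 : ∫ t in Ioi 0, tail F (fluidLevel m a d u t) ≤
        ∫ t in Ioi 0, tail F (u + t * min a d) := by
      refine setIntegral_mono_on (integrableOn_tail_fluidLevel m hF0 hint ha hd0 hu0)
        (integrableOn_tail_add_mul hF0 hint u 0 (lt_min ha hd0)) measurableSet_Ioi fun t ht => ?_
      have ht0 : 0 < t := ht
      refine tail_antitone F (le_min ?_ ?_)
      · gcongr; exact min_le_left _ _
      · have : u ≤ m * u := le_mul_of_one_le_left hu0 one_le_cast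
        gcongr; exact min_le_right _ _
    rwa [integral_tail_add_mul _ _ (lt_min ha hd0), zero_mul, add_zero] at h2
  -- On this event `n` is the smallest index with an exceedance, which makes the events disjoint.
  -- The excluded sets depend only on indices below `n`, so they are independent of `x n`, and each
  -- has probability at most `δ / 2`.
  set D : ℕ → Set (ℕ → ℝ) := fun n => (bad n ∪ early n)ᶜ ∩ {x | g n < x n} with hD
  have hDm : ∀ n, MeasurableSet (D n) := fun n => ((hmB n).union (hmE n)).compl.inter (hmA n)
  have hDdisj : Set.PairwiseDisjoint (Finset.range (N + 1) : Set ℕ) D := by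
    have key : ∀ k n, k < n → Disjoint (D k) (D n) := fun k n hkn =>
      disjoint_left.2 fun x hk hn =>
        hn.1 (Or.inr (mem_biUnion (Finset.mem_coe.2 (Finset.mem_range.2 hkn)) hk.2))
    intro k _ n _ hkn
    rcases lt_or_gt_of_ne hkn with h | h
    · exact key k n h
    · exact (key n k h).symm
  have hDreal : ∀ n, (1 - δ) * tail F (g n) ≤ (seqLaw F).real (D n) := fun n => by
    rw [hD, real_head_inter_coord F ((hmB n).union (hmE n)).compl n fun h t => ?_]
    · refine mul_le_mul_of_nonneg_right ?_ (tail_nonneg F _)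
      rw [measureReal_compl ((hmB n).union (hmE n)), probReal_univ]
      have h1 := measureReal_union_le (μ := seqLaw F) (bad n) (early n)
      have h2 := hB C le_rfl n
      have h3 := (measureReal_biUnion_finset_le (μ := seqLaw F) (Finset.range n)
        fun j => {x | g j < x j}).trans ((Finset.sum_congr rfl fun j _ =>
          real_coord_gt F j (g j)).le.trans (hsum n))
      linarith
    · rw [mem_compl_iff, mem_compl_iff, not_iff_not, mem_union, mem_union]
      refine or_congr (splice_mem_aboveLine h t) ?_
      simp only [hearly, mem_iUnion, Finset.mem_range, exists_prop, mem_ofPred_eq]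
      exact exists_congr fun j => and_congr_right fun hj => by rw [splice_of_lt hj]
  rw [Finset.mul_sum]
  refine (Finset.sum_le_sum fun n _ => hDreal n).trans ?_
  rw [← measureReal_biUnion_finset hDdisj fun n _ => hDm n]
  refine ENNReal.toReal_mono (measure_ne_top _ _) (measure_mono_ae ?_)
  filter_upwards [ae_seqLaw_nonneg hF0] with x hx hxD
  obtain ⟨n, hn, hxn⟩ := mem_iUnion₂.1 hxD
  have h1 : x ∉ bad n := fun h => hxn.1 (Or.inl h)
  have h2 : walk (fun u => -u) n x ≤ C + (-b + ε * d) * n := by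
    by_contra! h
    exact h1 ⟨n, le_rfl, h⟩
  have e : walk (fun u => -u) n x = -walk id n x := by simp [walk]
  rw [e] at h2
  exact lt_pastDater (b := b) ha.le hε0.le hC (Nat.lt_succ_iff.1 (Finset.mem_range.1 hn)) hx
    (by linarith) hxn.2

end Lower

/-! ### Asymptotics of the tail of the stationary maximal dater -/

/-- A monotone limit exceeds `v` exactly when some term does. The sign change reads service times
backwards from the present customer. -/
lemma lt_stationaryDater_iff (m : ℕ) [NeZero m] (a : ℝ) (s : ℤ → ℝ) (v : ℝ) :
    (v : EReal) < stationaryDater m a s ↔ ∃ N, v < pastDater m a N fun j => s (-j) := by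
  have h : ∀ N, backwardDater m a s N = pastDater m a N fun j => s (-j) := fun N =>
    dater_eq_pastDater fun k hk => by
      congr 1
      omega
  have hlim := tendsto_stationaryDater m a s
  constructor
  · intro hv
    obtain ⟨N, hN⟩ := (hlim.eventually (lt_mem_nhds hv)).exists
    exact ⟨N, by rw [← h]; exact EReal.coe_lt_coe_iff.1 hN⟩
  · rintro ⟨N, hN⟩
    rw [← h] at hN
    refine (EReal.coe_lt_coe_iff.2 hN).trans_le ?_
    exact Monotone.ge_of_tendsto
      (f := fun n => (backwardDater m a s n : EReal))
      (fun _ _ hnk => EReal.coe_le_coe_iff.2 (backwardDater_mono m a s hnk)) hlim N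

/-- The asymptotic expression for the tail of the stationary maximal dater. -/
def daterTail (F : Measure ℝ) (m : ℕ) (a b x : ℝ) : ℝ :=
  1 / a * integratedTail F x + max (1 / (m * a - b) - 1 / a) 0
    * integratedTail F (b * x / (b - (m - 1) * a))

section Asymptotics

variable {F : Measure ℝ} [IsProbabilityMeasure F] (hF0 : F (Iio 0) = 0)
  (hint : Integrable (fun u : ℝ => u) F) (hFs : IsSubexponential (integratedDist F))
  (m : ℕ) [NeZero m] {a b : ℝ}

/-- With `d = m * a - b` the alternative `0 < a - d` is the positivity of `b - (m - 1) * a`: the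
argument of the second integrated tail tends to infinity whenever its coefficient is nonzero. -/
lemma second_coefficient_cases {a d : ℝ} (ha : 0 < a) :
    max (1 / d - 1 / a) 0 = 0 ∨ 0 < a - d := by
  rcases le_or_gt a d with h | h
  · left
    have h1 : 1 / d ≤ 1 / a := one_div_le_one_div_of_le ha h
    exact max_eq_right (by linarith)
  · exact Or.inr (by linarith)

include hF0 hint hFs

/-- Long-tailedness absorbs the shift `C` in the first term and the rescaled shift `b * C / (b - (m
- 1) * a)` in the second. -/
lemma eventually_fluidIntegral_le (ha : 0 < a) (hb : 0 < b) (hab : b < m * a) (C : ℝ) {κ : ℝ}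
    (hκ : 1 < κ) : ∀ᶠ v in atTop,
      fluidIntegral F m a (m * a - b) (v - C) ≤ κ * daterTail F m a b v := by
  have hd : 0 < m * a - b := by linarith
  have h2 : ∀ᶠ v in atTop, max (1 / (m * a - b) - 1 / a) 0 *
      excess F (b * (v - C) / (b - (m - 1) * a)) ≤ κ * (max (1 / (m * a - b) - 1 / a) 0 *
        integratedTail F (b * v / (b - (m - 1) * a))) := by
    rcases second_coefficient_cases (d := m * a - b) ha with h | h
    · exact Eventually.of_forall fun v => by rw [h, zero_mul, zero_mul, mul_zero]
    · have he : 0 < b - (m - 1) * a := by linarith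
      have ht : Tendsto (fun v : ℝ => b * v / (b - (m - 1) * a)) atTop atTop :=
        (tendsto_id.const_mul_atTop hb).atTop_div_const he
      filter_upwards [ht.eventually (eventually_excess_sub_le hF0 hint hFs
        (b * C / (b - (m - 1) * a)) hκ)] with v hv
      rw [← sub_div, ← mul_sub] at hv
      have := mul_le_mul_of_nonneg_left hv (le_max_right (1 / (m * a - b) - 1 / a) 0)
      linarith
  filter_upwards [h2, eventually_excess_sub_le hF0 hint hFs C hκ, eventually_ge_atTop C]
    with v h2 h1 hv
  rw [fluidIntegral_eq m hF0 hint ha hd (sub_nonneg.2 hv), daterTail,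
    show m * a - (m * a - b) = b by ring, show a - (m * a - b) = b - (m - 1) * a by ring]
  have := mul_le_mul_of_nonneg_left h1 (one_div_pos.2 ha).le
  linarith

lemma eventually_le_fluidIntegral (ha : 0 < a) (hb : 0 < b) (hab : b < m * a) (C : ℝ) {κ : ℝ}
    (hκ : 1 < κ) : ∀ᶠ v in atTop,
      daterTail F m a b v ≤ κ * fluidIntegral F m a (m * a - b) (v + C) := by
  have hd : 0 < m * a - b := by linarith
  have key : ∀ A, ∀ᶠ x in atTop, integratedTail F x ≤ κ * excess F (x + A) := fun A => by
    have ht : Tendsto (fun v : ℝ => v + A) atTop atTop :=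
      tendsto_atTop_add_const_right atTop A tendsto_id
    filter_upwards [ht.eventually (eventually_integratedTail_sub_le hF0 hint hFs A hκ)] with x hx
    rw [add_sub_cancel_right] at hx
    refine hx.trans (mul_le_mul_of_nonneg_left ?_ (by linarith))
    rw [integratedTail_eq hF0 hint]
    exact min_le_right _ _
  have h2 : ∀ᶠ v in atTop, max (1 / (m * a - b) - 1 / a) 0 *
      integratedTail F (b * v / (b - (m - 1) * a)) ≤ κ * (max (1 / (m * a - b) - 1 / a) 0 *
        excess F (b * (v + C) / (b - (m - 1) * a))) := by
    rcases second_coefficient_cases (d := m * a - b) ha with h | h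
    · exact Eventually.of_forall fun v => by rw [h, zero_mul, zero_mul, mul_zero]
    · have he : 0 < b - (m - 1) * a := by linarith
      have ht : Tendsto (fun v : ℝ => b * v / (b - (m - 1) * a)) atTop atTop :=
        (tendsto_id.const_mul_atTop hb).atTop_div_const he
      filter_upwards [ht.eventually (key (b * C / (b - (m - 1) * a)))] with v hv
      rw [← add_div, ← mul_add] at hv
      have := mul_le_mul_of_nonneg_left hv (le_max_right (1 / (m * a - b) - 1 / a) 0)
      linarith
  filter_upwards [h2, key C, eventually_ge_atTop (-C)] with v h2 h1 hv
  rw [fluidIntegral_eq m hF0 hint ha hd (by linarith), daterTail,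
    show m * a - (m * a - b) = b by ring, show a - (m * a - b) = b - (m - 1) * a by ring]
  have := mul_le_mul_of_nonneg_left h1 (one_div_pos.2 ha).le
  linarith

omit [NeZero m] in
-- Errors measured against the integrated tail at `x` thereby become errors relative to the claimed
-- asymptotics.
lemma integratedTail_le_mul_daterTail (ha : 0 < a) (x : ℝ) :
    integratedTail F x ≤ a * daterTail F m a b x := by
  have h1 : 0 ≤ max (1 / (m * a - b) - 1 / a) 0
    * integratedTail F (b * x / (b - (m - 1) * a)) :=
    mul_nonneg (le_max_right _ _) (integratedTail_pos hF0 hint hFs _).le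
  have h2 : a * (1 / a * integratedTail F x) = integratedTail F x := by field_simp
  rw [daterTail, mul_add, h2]
  exact le_add_of_nonneg_right (mul_nonneg ha.le h1)

omit [NeZero m] in
lemma daterTail_pos (ha : 0 < a) (x : ℝ) : 0 < daterTail F m a b x := by
  have h1 := integratedTail_le_mul_daterTail hF0 hint hFs m (b := b) ha x
  have h2 := integratedTail_pos hF0 hint hFs x
  exact pos_of_mul_pos_right (h2.trans_le h1) ha.le

lemma eventually_real_pastDater_le (ha : 0 < a) (hb : ∫ u, u ∂F = b) (hb0 : 0 < b)
    (hab : b < m * a) {η : ℝ} (hη0 : 0 < η) (hη1 : η ≤ 1) : ∀ᶠ v in atTop,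
      (seqLaw F).real {x | ∃ N, v < pastDater m a N x} ≤ (1 + η) * daterTail F m a b v := by
  have hd : 0 < m * a - b := by linarith
  have hκ : (1 : ℝ) < 1 + η / 4 := by linarith
  -- Chosen so that the time change costs the factor `1 / (1 - ε) = 1 + η / 4`.
  set ε := (η / 4) / (1 + η / 4) with hε
  have hε0 : 0 < ε := by positivity
  have hε1 : 1 - ε = 1 / (1 + η / 4) := by rw [hε]; field_simp; ring
  have hε2 : 0 < 1 - ε := by rw [hε1]; positivity
  have hδ : 0 < η / (8 * a) := by positivity
  obtain ⟨C, hC, h⟩ := exists_real_pastDater_le hF0 hint m hFs ha hb hb0.le hab hε0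
    (by linarith) hδ
  filter_upwards [h, eventually_tail_sub_le_integratedTail hF0 hint hFs C hδ,
    eventually_fluidIntegral_le hF0 hint hFs m ha hb0 hab C hκ, eventually_ge_atTop C]
    with v h1 h2 h3 hv
  have hu : 0 ≤ v - C := sub_nonneg.2 hv
  have hG := integratedTail_le_mul_daterTail hF0 hint hFs m (b := b) ha v
  have hr := daterTail_pos hF0 hint hFs m (b := b) ha v
  have hbound : ∀ N, (seqLaw F).real {x | v < pastDater m a N x} ≤
      (1 + η) * daterTail F m a b v := fun N => by
    refine (h1 N).trans ?_
    have h4 := sum_le_add_integral (antitone_tail_fluidLevel (F := F) m ha.le hd.le (v - C))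
      (fun t => tail_nonneg F _) (integrableOn_tail_fluidLevel m hF0 hint ha hd hu) hε2 (N + 1)
    rw [fluidLevel_zero m hu] at h4
    have h5 : fluidIntegral F m a (m * a - b) (v - C) / (1 - ε) ≤
        (1 + η / 4) * ((1 + η / 4) * daterTail F m a b v) := by
      rw [hε1, div_div_eq_mul_div, div_one, mul_comm]
      exact mul_le_mul_of_nonneg_left h3 (by linarith)
    have h6 : η / (8 * a) * integratedTail F v ≤ η / 8 * daterTail F m a b v := by
      calc _ ≤ η / (8 * a) * (a * daterTail F m a b v) := mul_le_mul_of_nonneg_left hG hδ.le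
        _ = _ := by field_simp
    have h7 : η * η * daterTail F m a b v ≤ η * daterTail F m a b v :=
      mul_le_mul_of_nonneg_right (by nlinarith) hr.le
    have h8 := mul_pos hη0 hr
    unfold fluidIntegral at h5
    linarith
  have hmono : Monotone fun N => {x : ℕ → ℝ | v < pastDater m a N x} := fun N M hNM x hx =>
    lt_of_lt_of_le hx (pastDater_mono m a x hNM)
  -- The bound is uniform in `N` and the events increase, so it passes to their union.
  have hlim := tendsto_measure_iUnion_atTop (μ := seqLaw F) hmono
  have hlim' := (ENNReal.tendsto_toReal (measure_ne_top _ _)).comp hlim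
  have e : {x : ℕ → ℝ | ∃ N, v < pastDater m a N x} = ⋃ N, {x | v < pastDater m a N x} := by
    ext x; simp
  rw [e]
  exact le_of_tendsto hlim' (Eventually.of_forall hbound)

lemma eventually_le_real_pastDater (ha : 0 < a) (hb : ∫ u, u ∂F = b) (hb0 : 0 < b)
    (hab : b < m * a) {η : ℝ} (hη0 : 0 < η) (hη1 : η ≤ 1) : ∀ᶠ v in atTop,
      (1 - η) * daterTail F m a b v ≤ (seqLaw F).real {x | ∃ N, v < pastDater m a N x} := by
  have hd : 0 < m * a - b := by linarith
  have hκ : (1 : ℝ) < 1 + η / 4 := by linarith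
  have hε0 : 0 < η / 4 := by positivity
  obtain ⟨C, hC, h⟩ := exists_le_real_pastDater hF0 hint m ha hb hab hε0 hε0
  filter_upwards [h, eventually_le_fluidIntegral hF0 hint hFs m ha hb0 hab C hκ,
    eventually_ge_atTop 0] with v h1 h3 hv
  have hu : 0 ≤ v + C := by linarith
  have hr := daterTail_pos hF0 hint hFs m (b := b) ha v
  have hN : Tendsto (fun N : ℕ => (1 + η / 4) * ((N + 1 : ℕ) : ℝ)) atTop atTop :=
    (tendsto_natCast_atTop_atTop.comp (tendsto_add_atTop_nat 1)).const_mul_atTop (by linarith)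
  -- For fixed `v` the finite sums dominate integrals over growing intervals; letting `N` tend to
  -- infinity recovers the whole fluid integral.
  have hlim := ((intervalIntegral_tendsto_integral_Ioi 0
    (integrableOn_tail_fluidLevel (F := F) m hF0 hint ha hd hu) hN).div_const
    (1 + η / 4)).const_mul (1 - η / 4)
  have h4 : (1 - η / 4) * (fluidIntegral F m a (m * a - b) (v + C) / (1 + η / 4)) ≤
      (seqLaw F).real {x | ∃ N, v < pastDater m a N x} := by
    refine le_of_tendsto hlim (Eventually.of_forall fun N => ?_)
    have h5 := integral_le_sum (antitone_tail_fluidLevel (F := F) m ha.le hd.le (v + C))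
      (show 0 < 1 + η / 4 by linarith) (N + 1)
    refine (mul_le_mul_of_nonneg_left h5 (by linarith)).trans ((h1 N).trans ?_)
    exact measureReal_mono fun x hx => ⟨N, hx⟩
  refine le_trans ?_ h4
  have h6 : daterTail F m a b v / (1 + η / 4) / (1 + η / 4) ≤
      fluidIntegral F m a (m * a - b) (v + C) / (1 + η / 4) := by
    gcongr
    rw [div_le_iff₀' (by linarith)]
    exact h3
  refine le_trans ?_ (mul_le_mul_of_nonneg_left h6 (by linarith))
  rw [div_div, mul_div_assoc', le_div_iff₀ (by positivity)]
  have h7 : (1 - η) * ((1 + η / 4) * (1 + η / 4)) ≤ 1 - η / 4 := by nlinarith [pow_pos hη0 3]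
  nlinarith

end Asymptotics

end MultiserverTail

end

theorem theorem13 {Ω : Type*} [MeasurableSpace Ω] (P : Measure Ω) [IsProbabilityMeasure P]
    (m : ℕ) [NeZero m] (a b : ℝ) (ha : 0 < a)
    (F : Measure ℝ) [IsProbabilityMeasure F]
    (hF : MultiserverTail.IsSubexponential F)
    (hFs : MultiserverTail.IsSubexponential (MultiserverTail.integratedDist F))
    (hmean : Integrable (fun u : ℝ => u) F) (hb : ∫ u, u ∂F = b)
    (hρ : b / (m * a) ∈ Ioo (0 : ℝ) 1)
    (σ : ℤ → Ω → ℝ) (hindep : iIndepFun σ P) (hlaw : ∀ n, HasLaw (σ n) F P) :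
    ((fun x : ℝ =>
        P.real {ω | (x : EReal) < MultiserverTail.stationaryDater m a (fun n => σ n ω)})
      ~[atTop] fun x : ℝ =>
        1 / a * MultiserverTail.integratedTail F x
          + max (1 / (m * a - b) - 1 / a) 0
            * MultiserverTail.integratedTail F (b * x / (b - (m - 1) * a)))
    ∧ (b ≤ (m - 1) * a → ∀ x : ℝ,
        max (1 / (m * a - b) - 1 / a) 0
          * MultiserverTail.integratedTail F (b * x / (b - (m - 1) * a)) = 0) := by
  have hma : 0 < m * a := mul_pos (by exact_mod_cast NeZero.pos m) ha
  have hb0 : 0 < b := by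
    have := mul_pos hρ.1 hma
    rwa [div_mul_cancel₀ _ hma.ne'] at this
  have hab : b < m * a := (div_lt_one hma).1 hρ.2
  constructor
  -- The service times at indices `0, -1, -2, …` form an independent sequence with law `F`, and the
  -- stationary dater is a function of these alone.
  · have hX : HasLaw (fun ω (j : ℕ) => σ (-j) ω) (MultiserverTail.seqLaw F) P :=
      (hindep.precomp (g := fun j : ℕ => -(j : ℤ)) fun i j hij => by simpa using hij)
        |>.hasLaw_infinitePi (fun j => hlaw _)
          (aemeasurable_pi_iff.2 fun j => (hlaw _).aemeasurable)
    have hP : ∀ v : ℝ,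
        P.real {ω | (v : EReal) < MultiserverTail.stationaryDater m a (fun n => σ n ω)} =
        (MultiserverTail.seqLaw F).real {x | ∃ N, v < MultiserverTail.pastDater m a N x} := by
      intro v
      have hmeas : MeasurableSet {x : ℕ → ℝ | ∃ N, v < MultiserverTail.pastDater m a N x} := by
        simp only [ofPred_exists]
        exact MeasurableSet.iUnion fun N =>
          measurableSet_lt measurable_const (MultiserverTail.measurable_pastDater m a N)
      simp_rw [MultiserverTail.lt_stationaryDater_iff]
      exact hX.measureReal_eq hmeas
    simp_rw [hP]
    refine isLittleO_iff.2 fun c hc => ?_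
    have hη0 : 0 < min c 1 := lt_min hc one_pos
    filter_upwards [MultiserverTail.eventually_real_pastDater_le hF.nonneg hmean hFs m ha hb hb0
        hab hη0 (min_le_right _ _),
      MultiserverTail.eventually_le_real_pastDater hF.nonneg hmean hFs m ha hb hb0 hab hη0
        (min_le_right _ _)] with v h1 h2
    have hr := MultiserverTail.daterTail_pos hF.nonneg hmean hFs m (b := b) ha v
    change ‖_ - MultiserverTail.daterTail F m a b v‖ ≤ c * ‖MultiserverTail.daterTail F m a b v‖
    have hc' := mul_le_mul_of_nonneg_right (min_le_left c 1) hr.le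
    rw [Real.norm_of_nonneg hr.le, Real.norm_eq_abs, abs_le]
    constructor <;> linarith
  · intro h x
    have h1 : 1 / (m * a - b) ≤ 1 / a := one_div_le_one_div_of_le ha (by linarith)
    rw [max_eq_right (by linarith), zero_mul]
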